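/- Let $\beta\ge 0$, let $\boldsymbol\beta=(\beta_p)_{p\ge1}$ be real numbers with $\sum_{p\ge 1}2^p\beta_p^2<\infty$, and let $h$ be a Gaussian random variable (of arbitrary mean and variance, possibly degenerate). On one probability space let there be given, for every $N\ge1$, independent random variables $(g_{i_1,\dots,i_{2p}}:\ p\ge 1,\ 1\le i_1,\dots,i_{2p}\le N)$ and $(h_i)_{i\le N}$, where the $g$'s are standard Gaussian and the $h_i$ are copies of $h$ (the families for different $N$ may be restrictions of a single family, or be coupled in any other way; their dependence on $N$ is not written). For $\sigma\in\{-1,+1\}^N$ put $m(\sigma)=N^{-1}\sum_{i\le N}\sigma_i$, $$H_N^{SK}(\sigma)=\sum_{p\ge1}\frac{\beta_p}{N^{p-1/2}}\sum_{1\le i_1,\dots,i_{2p}\le N}g_{i_1,\dots,i_{2p}}\sigma_{i_1}\cdots\sigma_{i_{2p}},\qquad H_N(\sigma)=\frac{\beta N}{2}m(\sigma)^2+H_N^{SK}(\sigma)+\sum_{i\le N}h_i\sigma_i .$$ Let $\langle\cdot\rangle$ be the average with respect to the Gibbs measure on $\{-1,+1\}^N$ with weights proportional to $\exp H_N(\sigma)$.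 For $x\in\mathbb R$ let $$F^{SK}(\boldsymbol\beta,x+h)=\lim_{N\to\infty}\frac1N\,\mathbb E\ln\sum_{\sigma\in\{-1,+1\}^N}\exp\Big(H^{SK}_N(\sigma)+\sum_{i\le N}(x+h_i)\sigma_i\Big),$$ and let $$\Omega=\operatorname*{Argmax}_{\mu\in[-1,1]}\Big\{F^{SK}(\boldsymbol\beta,\beta\mu+h)-\frac{\beta\mu^2}{2}\Big\}.$$ Then the limit defining $F^{SK}(\boldsymbol\beta,\beta\mu+h)$ exists for every $\mu\in[-1,1]$. Moreover, for every (relatively) open subset $U$ of $[-1,1]$ with $\inf\{|x-y|:x\in U,\ y\in\Omega\}>0$ (where $\inf\emptyset=+\infty$), there is a constant $K>0$, independent of $N$, such that for every $N\ge1$ $$\mathbb E\langle I(m\in U)\rangle\le K\exp\Big(-\frac NK\Big),$$ and, in particular, $\lim_{N\to\infty}\langle I(m\in U)\rangle=0$ almost surely. -/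

import Mathlib

open MeasureTheory ProbabilityTheory Filter Set
open scoped Topology NNReal

namespace SKFI

noncomputable section

/-- Spin configurations in `{-1, +1}^N`. -/
abbrev Config (N : ℕ) : Type := Fin N → ℤˣ

/-- The spin at site `i`, as a real number equal to `-1` or `+1`. -/
def spin {N : ℕ} (σ : Config N) (i : Fin N) : ℝ := ((σ i : ℤ) : ℝ)

/-- The magnetization per site `m(σ) = N⁻¹ ∑ i, σ i`. -/
def magnetization {N : ℕ} (σ : Config N) : ℝ := (∑ i, spin σ i) / N

/-- Indices of the couplings: an integer `p ≥ 1` with a tuple `(i₁, …, i₂ₚ)` of sites. -/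
abbrev CouplingIndex (N : ℕ) : Type := Σ p : ℕ+, (Fin (2 * (p : ℕ)) → Fin N)

/-- The mixed even-spin Sherrington-Kirkpatrick Hamiltonian
`∑_{p ≥ 1} βₚ / N^(p - 1/2) ∑_{i₁, …, i₂ₚ} g_{i₁, …, i₂ₚ} σ_{i₁} ⋯ σ_{i₂ₚ}`. -/
def hamiltonianSK {N : ℕ} (B : ℕ+ → ℝ) (g : CouplingIndex N → ℝ) (σ : Config N) : ℝ :=
  ∑' p : ℕ+, B p / (N : ℝ) ^ (((p : ℕ) : ℝ) - 1 / 2) *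
    ∑ i : Fin (2 * (p : ℕ)) → Fin N, g ⟨p, i⟩ * ∏ j, spin σ (i j)

/-- The Hamiltonian of the model with ferromagnetic interaction `β N m² / 2` and external
field `h`. -/
def hamiltonian {N : ℕ} (β : ℝ) (B : ℕ+ → ℝ) (g : CouplingIndex N → ℝ) (h : Fin N → ℝ)
    (σ : Config N) : ℝ :=
  β * N / 2 * magnetization σ ^ 2 + hamiltonianSK B g σ + ∑ i, h i * spin σ i

/-- The partition function. -/
def partitionFunction {N : ℕ} (β : ℝ) (B : ℕ+ → ℝ) (g : CouplingIndex N → ℝ)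
    (h : Fin N → ℝ) : ℝ :=
  ∑ σ : Config N, Real.exp (hamiltonian β B g h σ)

/-- The Gibbs weight of a configuration. -/
def gibbsWeight {N : ℕ} (β : ℝ) (B : ℕ+ → ℝ) (g : CouplingIndex N → ℝ) (h : Fin N → ℝ)
    (σ : Config N) : ℝ :=
  Real.exp (hamiltonian β B g h σ) / partitionFunction β B g h

/-- The Gibbs average of a function of one replica. -/
def gibbsAverage {N : ℕ} (β : ℝ) (B : ℕ+ → ℝ) (g : CouplingIndex N → ℝ) (h : Fin N → ℝ)
    (f : Config N → ℝ) : ℝ :=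
  ∑ σ : Config N, f σ * gibbsWeight β B g h σ

/-- The Gibbs probability `⟨I(m ∈ U)⟩`. -/
def gibbsMagnetization {N : ℕ} (β : ℝ) (B : ℕ+ → ℝ) (g : CouplingIndex N → ℝ)
    (h : Fin N → ℝ) (U : Set ℝ) : ℝ :=
  gibbsAverage β B g h fun σ => U.indicator (fun _ => (1 : ℝ)) (magnetization σ)

/-- The random variables `g` are i.i.d. standard Gaussian, the `h i` are i.i.d. Gaussian with
mean `a` and variance `v` (a point mass at `a` if `v = 0`), and `g` is independent of `h`. -/
structure IsDisorder {Ω : Type*} [MeasurableSpace Ω] (P : Measure Ω) (a : ℝ) (v : ℝ≥0) {N : ℕ}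
    (g : CouplingIndex N → Ω → ℝ) (h : Fin N → Ω → ℝ) : Prop where
  hasLaw_coupling : ∀ k, HasLaw (g k) (gaussianReal 0 1) P
  hasLaw_field : ∀ i, HasLaw (h i) (gaussianReal a v) P
  indep : iIndepFun (Sum.elim g h : CouplingIndex N ⊕ Fin N → Ω → ℝ) P

/-- The free energy `N⁻¹ E ln Z_N` of the model without ferromagnetic interaction (`β = 0`),
with couplings `g` and external field `h`. -/
def freeEnergySK {Ω : Type*} [MeasurableSpace Ω] (P : Measure Ω) {N : ℕ} (B : ℕ+ → ℝ)
    (g : CouplingIndex N → Ω → ℝ) (h : Fin N → Ω → ℝ) : ℝ :=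
  (∫ ω, Real.log (partitionFunction 0 B (fun k => g k ω) (fun i => h i ω)) ∂P) / N

/-- The limiting free energy `F^SK(B, x + h)` of the model without ferromagnetic interaction,
with external field shifted by the constant `x`. -/
def limitFreeEnergySK {Ω : Type*} [MeasurableSpace Ω] (P : Measure Ω) (B : ℕ+ → ℝ)
    (g : ∀ N, CouplingIndex N → Ω → ℝ) (h : ∀ N, Fin N → Ω → ℝ) (x : ℝ) : ℝ :=
  limUnder atTop fun N : ℕ => freeEnergySK P B (g N) fun i ω => x + h N i ω

/-- The set of maximizers over `μ ∈ [-1, 1]` of `F^SK(B, β μ + h) - β μ² / 2`. -/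
def argmaxSet {Ω : Type*} [MeasurableSpace Ω] (P : Measure Ω) (β : ℝ) (B : ℕ+ → ℝ)
    (g : ∀ N, CouplingIndex N → Ω → ℝ) (h : ∀ N, Fin N → Ω → ℝ) : Set ℝ :=
  {μ | μ ∈ Icc (-1 : ℝ) 1 ∧
    IsMaxOn (fun μ => limitFreeEnergySK P B g h (β * μ) - β * μ ^ 2 / 2) (Icc (-1) 1) μ}

end

end SKFI

namespace SKFI

theorem integrable_gaussianReal_zero_one_iff {f : ℝ → ℝ} :
    Integrable f (gaussianReal 0 1) ↔ Integrable (fun x => f x * gaussianPDFReal 0 1 x) := by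
  rw [gaussianReal_of_var_ne_zero _ one_ne_zero, integrable_withDensity_iff
    (measurable_gaussianPDF _ _) (ae_of_all _ fun _ => gaussianPDF_lt_top)]
  simp [toReal_gaussianPDF]

theorem hasDerivAt_gaussianPDFReal_zero_one (x : ℝ) :
    HasDerivAt (gaussianPDFReal 0 1) (-x * gaussianPDFReal 0 1 x) x := by
  have h : gaussianPDFReal 0 1 = fun x => (√(2 * Real.pi * 1))⁻¹ * Real.exp (-x ^ 2 / 2) := by
    ext x
    simp [gaussianPDFReal]
  rw [h]
  have h1 : HasDerivAt (fun x : ℝ => -x ^ 2 / 2) (-x) x := by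
    have h2 := ((hasDerivAt_pow 2 x).neg).div_const 2
    have e : -(((2 : ℕ) : ℝ) * x ^ (2 - 1)) / 2 = -x := by
      norm_num
      ring
    rwa [e] at h2
  have h3 := h1.exp.const_mul (√(2 * Real.pi * 1))⁻¹
  have e : -x * ((√(2 * Real.pi * 1))⁻¹ * Real.exp (-x ^ 2 / 2))
      = (√(2 * Real.pi * 1))⁻¹ * (Real.exp (-x ^ 2 / 2) * -x) := by ring
  rwa [e]

theorem integrable_id_gaussianReal_zero_one : Integrable (fun x : ℝ => x) (gaussianReal 0 1) :=
  (memLp_id_gaussianReal (μ := 0) (v := 1) 1).integrable (by simp)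

/-- Gaussian integration by parts in one variable. -/
theorem integral_id_mul_gaussianReal {f f' : ℝ → ℝ} {C C' : ℝ}
    (hf : ∀ x, HasDerivAt f (f' x) x) (hf' : Measurable f') (hC : ∀ x, |f x| ≤ C)
    (hC' : ∀ x, |f' x| ≤ C') :
    ∫ x, x * f x ∂gaussianReal 0 1 = ∫ x, f' x ∂gaussianReal 0 1 := by
  have hcont : Continuous f := continuous_iff_continuousAt.2 fun x => (hf x).continuousAt
  have i1 : Integrable f (gaussianReal 0 1) :=
    Integrable.of_bound hcont.aestronglyMeasurable C (ae_of_all _ hC)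
  have i2 : Integrable f' (gaussianReal 0 1) :=
    Integrable.of_bound hf'.aestronglyMeasurable C' (ae_of_all _ hC')
  have i3 : Integrable (fun x => x * f x) (gaussianReal 0 1) :=
    integrable_id_gaussianReal_zero_one.mul_bdd (c := C) hcont.aestronglyMeasurable (ae_of_all _ hC)
  rw [integrable_gaussianReal_zero_one_iff] at i1 i2 i3
  have key := integral_mul_deriv_eq_deriv_mul_of_integrable (u := f) (u' := f')
    (v := gaussianPDFReal 0 1) (v' := fun x => -x * gaussianPDFReal 0 1 x)
    (fun x _ => hf x) (fun x _ => hasDerivAt_gaussianPDFReal_zero_one x)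
    (by
      refine i3.neg.congr (ae_of_all _ fun x => ?_)
      simp only [Pi.neg_apply, Pi.mul_apply]
      ring) i2 i1
  rw [integral_gaussianReal_eq_integral_smul one_ne_zero,
    integral_gaussianReal_eq_integral_smul one_ne_zero]
  simp only [smul_eq_mul]
  have e1 : ∫ x, f x * (-x * gaussianPDFReal 0 1 x) = -∫ x, gaussianPDFReal 0 1 x * (x * f x) := by
    rw [← integral_neg]
    congr 1
    ext x
    ring
  rw [e1] at key
  have e2 : ∫ x, f' x * gaussianPDFReal 0 1 x = ∫ x, gaussianPDFReal 0 1 x * f' x := by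
    congr 1
    ext x
    ring
  linarith

theorem integrable_exp_mul_abs_gaussianReal (t : ℝ) :
    Integrable (fun x => Real.exp (t * |x|)) (gaussianReal 0 1) := by
  refine ((integrable_exp_mul_gaussianReal (μ := 0) (v := 1) t).add
    (integrable_exp_mul_gaussianReal (μ := 0) (v := 1) (-t))).mono' ?_ (ae_of_all _ fun x => ?_)
  · exact (by fun_prop : Continuous fun x : ℝ => Real.exp (t * |x|)).aestronglyMeasurable
  · rw [Real.norm_of_nonneg (Real.exp_pos _).le]
    simp only [Pi.add_apply]
    rcases abs_cases x with ⟨h, _⟩ | ⟨h, _⟩ <;> rw [h]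
    · linarith [Real.exp_pos (-t * x)]
    · have : t * -x = -t * x := by ring
      rw [this]
      linarith [Real.exp_pos (t * x)]

theorem continuous_of_abs_sub_le {f : ℝ → ℝ} {a : ℝ} (hf : ∀ x y, |f x - f y| ≤ a * |x - y|) :
    Continuous f := by
  have : LipschitzWith a.toNNReal f := LipschitzWith.of_dist_le_mul fun x y => by
    rw [Real.dist_eq, Real.dist_eq]
    exact (hf x y).trans (mul_le_mul_of_nonneg_right (Real.le_coe_toNNReal a) (abs_nonneg _))
  exact this.continuous

/-- A Lipschitz function of a standard Gaussian variable is sub-Gaussian. -/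
theorem lintegral_exp_lipschitz_gaussianReal {f : ℝ → ℝ} {a : ℝ}
    (hf : ∀ x y, |f x - f y| ≤ a * |x - y|) (s : ℝ) :
    ∫⁻ x, ENNReal.ofReal (Real.exp (s * (f x - ∫ y, f y ∂gaussianReal 0 1))) ∂gaussianReal 0 1
      ≤ ENNReal.ofReal (Real.exp (s ^ 2 * a ^ 2)) := by
  set γ := gaussianReal 0 1 with hγ
  have hc : Continuous f := continuous_of_abs_sub_le hf
  have ha : 0 ≤ a := by
    have := hf 1 0
    norm_num at this
    exact (abs_nonneg _).trans this
  have hb : ∀ x, |f x| ≤ |f 0| + a * |x| := fun x => by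
    have h1 := hf x 0
    rw [sub_zero] at h1
    have h2 := abs_sub_abs_le_abs_sub (f x) (f 0)
    linarith
  have hfi : Integrable f γ := by
    refine ((integrable_const |f 0|).add (integrable_id_gaussianReal_zero_one.abs.const_mul a)).mono'
      hc.aestronglyMeasurable (ae_of_all _ fun x => ?_)
    simpa using hb x
  have hexp : ∀ t : ℝ, Integrable (fun x => Real.exp (t * f x)) γ := fun t => by
    refine ((integrable_exp_mul_abs_gaussianReal (|t| * a)).const_mul (Real.exp (|t| * |f 0|))).mono'
      (by fun_prop : Continuous fun x => Real.exp (t * f x)).aestronglyMeasurable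
      (ae_of_all _ fun x => ?_)
    rw [Real.norm_of_nonneg (Real.exp_pos _).le, ← Real.exp_add, Real.exp_le_exp]
    calc t * f x ≤ |t * f x| := le_abs_self _
      _ = |t| * |f x| := abs_mul _ _
      _ ≤ |t| * (|f 0| + a * |x|) := mul_le_mul_of_nonneg_left (hb x) (abs_nonneg _)
      _ = _ := by ring
  have hjensen : Real.exp (-s * ∫ y, f y ∂γ) ≤ ∫ y, Real.exp (-s * f y) ∂γ := by
    rw [← integral_const_mul]
    exact convexOn_exp.map_integral_le Real.continuous_exp.continuousOn isClosed_univ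
      (ae_of_all _ fun _ => mem_univ _) (hfi.const_mul (-s)) (hexp (-s))
  have hprod : ∀ t : ℝ, ∀ φ : ℝ → ℝ, (∀ t : ℝ, Integrable (fun x => Real.exp (t * φ x)) γ) →
      Integrable (fun z : ℝ × ℝ => Real.exp (t * (φ z.1 - φ z.2))) (γ.prod γ) := fun t φ hφ => by
    refine ((hφ t).mul_prod (hφ (-t))).congr (ae_of_all _ fun z => ?_)
    simp only [← Real.exp_add]
    congr 1
    ring
  have hid : ∀ t : ℝ, Integrable (fun x => Real.exp (t * id x)) γ := fun t =>
    integrable_exp_mul_gaussianReal (μ := 0) (v := 1) t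
  have hprodI : ∀ t : ℝ, ∀ φ : ℝ → ℝ, ∫ z, Real.exp (t * (φ z.1 - φ z.2)) ∂γ.prod γ
      = (∫ x, Real.exp (t * φ x) ∂γ) * ∫ x, Real.exp (-t * φ x) ∂γ := fun t φ => by
    rw [← integral_prod_mul]
    congr 1
    ext z
    rw [← Real.exp_add]
    congr 1
    ring
  have hsymm : ∀ t : ℝ, ∀ φ : ℝ → ℝ, (∀ t : ℝ, Integrable (fun x => Real.exp (t * φ x)) γ) →
      ∫ z, Real.exp (t * (φ z.1 - φ z.2)) ∂γ.prod γ =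
        ∫ z, Real.cosh (t * (φ z.1 - φ z.2)) ∂γ.prod γ := fun t φ hφ => by
    have h1 : ∫ z, Real.exp (-t * (φ z.1 - φ z.2)) ∂γ.prod γ
        = ∫ z, Real.exp (t * (φ z.1 - φ z.2)) ∂γ.prod γ := by
      rw [hprodI, hprodI, neg_neg, mul_comm]
    have h2 : ∫ z, Real.cosh (t * (φ z.1 - φ z.2)) ∂γ.prod γ
        = ((∫ z, Real.exp (t * (φ z.1 - φ z.2)) ∂γ.prod γ)
          + ∫ z, Real.exp (-t * (φ z.1 - φ z.2)) ∂γ.prod γ) / 2 := by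
      rw [← integral_add (hprod t φ hφ) (hprod (-t) φ hφ), ← integral_div]
      congr 1
      ext z
      rw [Real.cosh_eq, neg_mul]
    rw [h2, h1]
    ring
  have hcoshint : ∀ t : ℝ, ∀ φ : ℝ → ℝ, (∀ t : ℝ, Integrable (fun x => Real.exp (t * φ x)) γ) →
      Integrable (fun z : ℝ × ℝ => Real.cosh (t * (φ z.1 - φ z.2))) (γ.prod γ) := fun t φ hφ => by
    refine (((hprod t φ hφ).add (hprod (-t) φ hφ)).div_const 2).congr (ae_of_all _ fun z => ?_)
    simp only [Pi.add_apply]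
    rw [Real.cosh_eq, neg_mul]
  have hmgf : ∀ t : ℝ, ∫ x, Real.exp (t * id x) ∂γ = Real.exp (t ^ 2 / 2) := fun t => by
    have := mgf_gaussianReal (p := γ) (X := id) (μ := 0) (v := 1) (by simp [hγ]) t
    simpa [mgf] using this
  have hmain : (∫ x, Real.exp (s * f x) ∂γ) * ∫ x, Real.exp (-s * f x) ∂γ
      ≤ Real.exp (s ^ 2 * a ^ 2) := by
    rw [← hprodI, hsymm s f hexp]
    calc ∫ z, Real.cosh (s * (f z.1 - f z.2)) ∂γ.prod γ
        ≤ ∫ z, Real.cosh (s * a * (id z.1 - id z.2)) ∂γ.prod γ := by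
          refine integral_mono (hcoshint s f hexp) (hcoshint (s * a) id hid) fun z => ?_
          simp only
          rw [Real.cosh_le_cosh, abs_mul, abs_mul, abs_mul, abs_of_nonneg ha, mul_assoc]
          exact mul_le_mul_of_nonneg_left (hf _ _) (abs_nonneg _)
      _ = Real.exp (s ^ 2 * a ^ 2) := by
          rw [← hsymm (s * a) id hid, hprodI, hmgf, hmgf, ← Real.exp_add]
          congr 1
          ring
  have hfin : Integrable (fun x => Real.exp (s * (f x - ∫ y, f y ∂γ))) γ := by
    refine ((hexp s).mul_const (Real.exp (-s * ∫ y, f y ∂γ))).congr (ae_of_all _ fun x => ?_)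
    simp only [← Real.exp_add]
    congr 1
    ring
  rw [← ofReal_integral_eq_lintegral_ofReal hfin (ae_of_all _ fun x => (Real.exp_pos _).le)]
  refine ENNReal.ofReal_le_ofReal (le_trans ?_ hmain)
  calc ∫ x, Real.exp (s * (f x - ∫ y, f y ∂γ)) ∂γ
      = ∫ x, Real.exp (s * f x) * Real.exp (-s * ∫ y, f y ∂γ) ∂γ := by
        congr 1
        ext x
        rw [← Real.exp_add]
        congr 1
        ring
    _ = (∫ x, Real.exp (s * f x) ∂γ) * Real.exp (-s * ∫ y, f y ∂γ) := integral_mul_const _ _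
    _ ≤ _ := mul_le_mul_of_nonneg_left hjensen (integral_nonneg fun x => (Real.exp_pos _).le)

/-- The law of a family of i.i.d. standard Gaussian variables. -/
noncomputable def stdGaussian (ι : Type*) [Fintype ι] : Measure (ι → ℝ) :=
  Measure.pi fun _ => gaussianReal 0 1

instance {ι : Type*} [Fintype ι] : IsProbabilityMeasure (stdGaussian ι) := by
  unfold stdGaussian
  infer_instance

theorem measurable_update_prod {ι : Type*} [DecidableEq ι] (k : ι) :
    Measurable fun p : (ι → ℝ) × ℝ => Function.update p.1 k p.2 := by
  refine measurable_pi_lambda _ fun i => ?_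
  by_cases h : i = k
  · subst h
    simpa using measurable_snd
  · simp only [Function.update_of_ne h]
    exact (measurable_pi_apply i).comp measurable_fst

section

variable {ι : Type*} [Fintype ι]

theorem measurePreserving_eval_stdGaussian (k : ι) :
    MeasurePreserving (fun z : ι → ℝ => z k) (stdGaussian ι) (gaussianReal 0 1) :=
  measurePreserving_eval (fun _ : ι => gaussianReal 0 1) k

theorem integrable_eval_stdGaussian (k : ι) : Integrable (fun z : ι → ℝ => z k) (stdGaussian ι) :=
  (measurePreserving_eval_stdGaussian k).integrable_comp_of_integrable
    integrable_id_gaussianReal_zero_one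

variable [DecidableEq ι]


/-- Resampling one coordinate preserves the law. -/
theorem measurePreserving_update_stdGaussian (k : ι) :
    MeasurePreserving (fun p : (ι → ℝ) × ℝ => Function.update p.1 k p.2)
      ((stdGaussian ι).prod (gaussianReal 0 1)) (stdGaussian ι) where
  measurable := measurable_update_prod k
  map_eq := by
    refine (Measure.pi_eq fun s hs => ?_).symm
    rw [Measure.map_apply (measurable_update_prod k) (MeasurableSet.univ_pi hs)]
    have hpre : (fun p : (ι → ℝ) × ℝ => Function.update p.1 k p.2) ⁻¹' univ.pi s
        = (univ.pi (Function.update s k univ)) ×ˢ s k := by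
      ext p
      simp only [mem_preimage, Set.mem_pi, mem_univ, forall_true_left, mem_prod]
      constructor
      · intro h
        refine ⟨fun i => ?_, by simpa using h k⟩
        by_cases hi : i = k
        · subst hi
          simp
        · simpa [Function.update_of_ne hi] using h i
      · rintro ⟨h1, h2⟩ i
        by_cases hi : i = k
        · subst hi
          simpa using h2
        · simpa [Function.update_of_ne hi] using h1 i
    rw [hpre, Measure.prod_prod, stdGaussian, Measure.pi_pi,
      ← Finset.mul_prod_erase Finset.univ _ (Finset.mem_univ k),
      ← Finset.mul_prod_erase Finset.univ (fun i => gaussianReal 0 1 (s i)) (Finset.mem_univ k)]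
    have : ∏ x ∈ Finset.univ.erase k, gaussianReal 0 1 (Function.update s k univ x)
        = ∏ x ∈ Finset.univ.erase k, gaussianReal 0 1 (s x) :=
      Finset.prod_congr rfl fun i hi => by rw [Function.update_of_ne (Finset.ne_of_mem_erase hi)]
    rw [this]
    simp [mul_comm]

theorem integral_update_stdGaussian {f : (ι → ℝ) → ℝ} (hf : Integrable f (stdGaussian ι)) (k : ι) :
    ∫ z, f z ∂stdGaussian ι
      = ∫ z, ∫ x, f (Function.update z k x) ∂gaussianReal 0 1 ∂stdGaussian ι := by
  have hp := measurePreserving_update_stdGaussian k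
  have h1 : Integrable (fun p : (ι → ℝ) × ℝ => f (Function.update p.1 k p.2))
      ((stdGaussian ι).prod (gaussianReal 0 1)) := hp.integrable_comp_of_integrable hf
  rw [← integral_prod _ h1]
  conv_lhs => rw [← hp.map_eq]
  exact integral_map hp.measurable.aemeasurable (by rw [hp.map_eq]; exact hf.aestronglyMeasurable)

theorem lintegral_update_stdGaussian {f : (ι → ℝ) → ENNReal} (hf : Measurable f) (k : ι) :
    ∫⁻ z, f z ∂stdGaussian ι
      = ∫⁻ z, ∫⁻ x, f (Function.update z k x) ∂gaussianReal 0 1 ∂stdGaussian ι := by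
  have hp := measurePreserving_update_stdGaussian k
  rw [← hp.lintegral_comp hf]
  exact lintegral_prod _ (hf.comp hp.measurable).aemeasurable

/-- Gaussian integration by parts in one coordinate. -/
theorem integral_eval_mul_stdGaussian {f f' : (ι → ℝ) → ℝ} {C C' : ℝ} (k : ι)
    (hf : ∀ z x, HasDerivAt (fun x => f (Function.update z k x)) (f' (Function.update z k x)) x)
    (hfm : Measurable f) (hf' : Measurable f') (hC : ∀ z, |f z| ≤ C) (hC' : ∀ z, |f' z| ≤ C') :
    ∫ z, z k * f z ∂stdGaussian ι = ∫ z, f' z ∂stdGaussian ι := by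
  have i1 : Integrable (fun z : ι → ℝ => z k * f z) (stdGaussian ι) :=
    (integrable_eval_stdGaussian k).mul_bdd (c := C) hfm.aestronglyMeasurable (ae_of_all _ hC)
  have i2 : Integrable f' (stdGaussian ι) :=
    Integrable.of_bound hf'.aestronglyMeasurable C' (ae_of_all _ hC')
  rw [integral_update_stdGaussian i1 k, integral_update_stdGaussian i2 k]
  congr 1
  ext z
  simp only [Function.update_self]
  exact integral_id_mul_gaussianReal (hf z) (hf'.comp (measurable_update z)) (fun x => hC _)
    (fun x => hC' _)

/-- `G` is Lipschitz in each coordinate `k`, with constant `a k`. -/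
def CoordLipschitz (a : ι → ℝ) (G : (ι → ℝ) → ℝ) : Prop :=
  ∀ z k x y, |G (Function.update z k x) - G (Function.update z k y)| ≤ a k * |x - y|

theorem CoordLipschitz.abs_sub_le_sum {a : ι → ℝ} {G : (ι → ℝ) → ℝ} (hG : CoordLipschitz a G)
    (z w : ι → ℝ) : |G z - G w| ≤ ∑ k, a k * |z k - w k| := by
  have key : ∀ s : Finset ι, |G (s.piecewise z w) - G w| ≤ ∑ k ∈ s, a k * |z k - w k| := by
    intro s
    induction s using Finset.induction_on with
    | empty => simp
    | insert j s hj ih =>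
      rw [Finset.sum_insert hj, Finset.piecewise_insert]
      have h1 := hG (s.piecewise z w) j (z j) (w j)
      have h2 : Function.update (s.piecewise z w) j (w j) = s.piecewise z w := by
        conv_rhs => rw [← Function.update_eq_self j (s.piecewise z w)]
        rw [Finset.piecewise_eq_of_notMem _ _ _ hj]
      rw [h2] at h1
      have h3 := abs_sub_le (G (Function.update (s.piecewise z w) j (z j))) (G (s.piecewise z w))
        (G w)
      linarith
  simpa using key Finset.univ

theorem CoordLipschitz.continuous {a : ι → ℝ} {G : (ι → ℝ) → ℝ} (hG : CoordLipschitz a G) :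
    Continuous G := by
  rw [continuous_iff_continuousAt]
  intro w
  rw [ContinuousAt, tendsto_iff_dist_tendsto_zero]
  have h : Tendsto (fun z : ι → ℝ => ∑ k, a k * |z k - w k|) (𝓝 w) (𝓝 0) := by
    have : Continuous fun z : ι → ℝ => ∑ k, a k * |z k - w k| := by fun_prop
    simpa using this.tendsto w
  exact squeeze_zero (fun _ => dist_nonneg) (fun z => by
    rw [Real.dist_eq]
    exact hG.abs_sub_le_sum z w) h

theorem CoordLipschitz.integrable {a : ι → ℝ} {G : (ι → ℝ) → ℝ} (hG : CoordLipschitz a G) :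
    Integrable G (stdGaussian ι) := by
  have h1 : Integrable (fun z : ι → ℝ => |G 0| + ∑ k, a k * |z k|) (stdGaussian ι) :=
    (integrable_const _).add
      (integrable_finsetSum _ fun k _ => (integrable_eval_stdGaussian k).abs.const_mul _)
  refine h1.mono' hG.continuous.aestronglyMeasurable (ae_of_all _ fun z => ?_)
  have h2 := hG.abs_sub_le_sum z 0
  simp only [Pi.zero_apply, sub_zero] at h2
  rw [Real.norm_eq_abs]
  linarith [abs_sub_abs_le_abs_sub (G z) (G 0)]

/-- A function of i.i.d. standard Gaussian variables that is Lipschitz in each coordinate is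
sub-Gaussian. -/
theorem CoordLipschitz.lintegral_exp_le {a : ι → ℝ} {G : (ι → ℝ) → ℝ} (hG : CoordLipschitz a G)
    (s : ℝ) :
    ∫⁻ z, ENNReal.ofReal (Real.exp (s * (G z - ∫ w, G w ∂stdGaussian ι))) ∂stdGaussian ι
      ≤ ENNReal.ofReal (Real.exp (s ^ 2 * ∑ k, a k ^ 2)) := by
  have key : ∀ (S : Finset ι) (a : ι → ℝ) (G : (ι → ℝ) → ℝ), CoordLipschitz a G →
      (∀ k ∉ S, a k = 0) →
      ∫⁻ z, ENNReal.ofReal (Real.exp (s * (G z - ∫ w, G w ∂stdGaussian ι))) ∂stdGaussian ι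
      ≤ ENNReal.ofReal (Real.exp (s ^ 2 * ∑ k ∈ S, a k ^ 2)) := by
    intro S
    induction S using Finset.induction_on with
    | empty =>
      intro a G hG ha
      have hconst : ∀ z, G z = G 0 := fun z => by
        have h := hG.abs_sub_le_sum z 0
        rw [Finset.sum_eq_zero (fun k _ => by rw [ha k (Finset.notMem_empty k), zero_mul])] at h
        exact sub_eq_zero.1 (abs_nonpos_iff.1 h)
      simp [hconst]
    | insert j S hj ih =>
      intro a G hG ha
      set G' : (ι → ℝ) → ℝ := fun z => ∫ x, G (Function.update z j x) ∂gaussianReal 0 1 with hG'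
      have hsect : ∀ z, Integrable (fun x => G (Function.update z j x)) (gaussianReal 0 1) := by
        intro z
        have hb := ((integrable_const |G (Function.update z j 0)|).add
          (integrable_id_gaussianReal_zero_one.abs.const_mul (a j)))
        refine hb.mono' (continuous_of_abs_sub_le (hG z j)).aestronglyMeasurable
          (ae_of_all _ fun x => ?_)
        have h2 := hG z j x 0
        rw [sub_zero] at h2
        simp only [Pi.add_apply]
        rw [Real.norm_eq_abs]
        linarith [abs_sub_abs_le_abs_sub (G (Function.update z j x)) (G (Function.update z j 0))]
      have hupd : ∀ z x, G' (Function.update z j x) = G' z := fun z x => by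
        simp [hG', Function.update_idem]
      have hGint : ∫ w, G w ∂stdGaussian ι = ∫ w, G' w ∂stdGaussian ι :=
        integral_update_stdGaussian hG.integrable j
      have hL : CoordLipschitz (Function.update a j 0) G' := by
        intro z k x y
        by_cases hk : k = j
        · subst hk
          simp [hupd]
        · rw [Function.update_of_ne hk, hG', ← integral_sub (hsect _) (hsect _)]
          have h := norm_integral_le_of_norm_le_const (μ := gaussianReal 0 1) (C := a k * |x - y|)
            (f := fun t => G (Function.update (Function.update z k x) j t)
              - G (Function.update (Function.update z k y) j t))
            (ae_of_all _ fun t => by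
              rw [Function.update_comm hk, Function.update_comm hk]
              exact hG _ k x y)
          simpa using h
      have ih' := ih _ _ hL (fun k hk => by
        by_cases hkj : k = j
        · subst hkj
          simp
        · rw [Function.update_of_ne hkj]
          exact ha k (by simp [hkj, hk]))
      have hsum : ∑ k ∈ S, (Function.update a j 0) k ^ 2 = ∑ k ∈ S, a k ^ 2 :=
        Finset.sum_congr rfl fun k hk => by
          rw [Function.update_of_ne (ne_of_mem_of_not_mem hk hj)]
      rw [hsum] at ih'
      have hmeas : Measurable fun z => ENNReal.ofReal
          (Real.exp (s * (G z - ∫ w, G w ∂stdGaussian ι))) := by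
        have := hG.continuous.measurable
        fun_prop
      rw [lintegral_update_stdGaussian hmeas j, hGint]
      set c := ∫ w, G' w ∂stdGaussian ι
      calc ∫⁻ z, ∫⁻ x, ENNReal.ofReal (Real.exp (s * (G (Function.update z j x) - c)))
              ∂gaussianReal 0 1 ∂stdGaussian ι
          ≤ ∫⁻ z, ENNReal.ofReal (Real.exp (s ^ 2 * a j ^ 2))
              * ENNReal.ofReal (Real.exp (s * (G' z - c))) ∂stdGaussian ι := by
            refine lintegral_mono fun z => ?_
            have h1 : ∀ x, ENNReal.ofReal (Real.exp (s * (G (Function.update z j x) - c)))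
                = ENNReal.ofReal (Real.exp (s * (G (Function.update z j x) - G' z)))
                  * ENNReal.ofReal (Real.exp (s * (G' z - c))) := fun x => by
              rw [← ENNReal.ofReal_mul (Real.exp_pos _).le, ← Real.exp_add]
              congr 2
              ring
            simp only [h1]
            rw [lintegral_mul_const' _ _ ENNReal.ofReal_ne_top]
            exact mul_le_mul_left (lintegral_exp_lipschitz_gaussianReal (hG z j) s) _
        _ = ENNReal.ofReal (Real.exp (s ^ 2 * a j ^ 2))
              * ∫⁻ z, ENNReal.ofReal (Real.exp (s * (G' z - c))) ∂stdGaussian ι :=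
            lintegral_const_mul' _ _ ENNReal.ofReal_ne_top
        _ ≤ ENNReal.ofReal (Real.exp (s ^ 2 * a j ^ 2))
              * ENNReal.ofReal (Real.exp (s ^ 2 * ∑ k ∈ S, a k ^ 2)) := by gcongr
        _ = _ := by
            rw [← ENNReal.ofReal_mul (Real.exp_pos _).le, ← Real.exp_add, Finset.sum_insert hj,
              mul_add]
  exact key Finset.univ a G hG (by simp)

end

section

variable {S : Type*} [Fintype S]

/-- The log-partition function of the energies `y`. -/
noncomputable def logSumExp (y : S → ℝ) : ℝ := Real.log (∑ σ, Real.exp (y σ))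

/-- The average of `f` with respect to the Gibbs measure with energies `y`. -/
noncomputable def softAverage (y f : S → ℝ) : ℝ :=
  (∑ σ, f σ * Real.exp (y σ)) / ∑ σ, Real.exp (y σ)

theorem softAverage_sub (y f g : S → ℝ) :
    softAverage y (fun σ => f σ - g σ) = softAverage y f - softAverage y g := by
  simp [softAverage, sub_mul, Finset.sum_sub_distrib, sub_div]

theorem softAverage_sum {κ : Type*} (s : Finset κ) (y : S → ℝ) (f : κ → S → ℝ) :
    softAverage y (fun σ => ∑ k ∈ s, f k σ) = ∑ k ∈ s, softAverage y (f k) := by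
  simp only [softAverage, Finset.sum_mul]
  rw [Finset.sum_comm, Finset.sum_div]

theorem softAverage_const_mul (a : ℝ) (y f : S → ℝ) :
    softAverage y (fun σ => a * f σ) = a * softAverage y f := by
  simp [softAverage, mul_assoc, ← Finset.mul_sum, mul_div_assoc]

theorem softAverage_mono (y : S → ℝ) {f g : S → ℝ} (h : ∀ σ, f σ ≤ g σ) :
    softAverage y f ≤ softAverage y g := by
  unfold softAverage
  exact div_le_div_of_nonneg_right (Finset.sum_le_sum fun σ _ =>
    mul_le_mul_of_nonneg_right (h σ) (Real.exp_pos _).le)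
    (Finset.sum_nonneg fun σ _ => (Real.exp_pos _).le)

variable [Nonempty S]

theorem sum_exp_pos (y : S → ℝ) : 0 < ∑ σ, Real.exp (y σ) :=
  Finset.sum_pos (fun _ _ => Real.exp_pos _) Finset.univ_nonempty

theorem softAverage_const (y : S → ℝ) (a : ℝ) : softAverage y (fun _ => a) = a := by
  rw [softAverage, ← Finset.mul_sum, mul_div_assoc, div_self (sum_exp_pos y).ne', mul_one]

theorem abs_softAverage_le (y : S → ℝ) {f : S → ℝ} {C : ℝ} (h : ∀ σ, |f σ| ≤ C) :
    |softAverage y f| ≤ C := by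
  rw [abs_le]
  constructor
  · rw [← softAverage_const y (-C)]
    exact softAverage_mono y fun σ => (abs_le.1 (h σ)).1
  · conv_rhs => rw [← softAverage_const y C]
    exact softAverage_mono y fun σ => (abs_le.1 (h σ)).2

theorem exp_logSumExp (y : S → ℝ) : Real.exp (logSumExp y) = ∑ σ, Real.exp (y σ) :=
  Real.exp_log (sum_exp_pos y)

theorem logSumExp_le_of_le {y y' : S → ℝ} {c : ℝ} (h : ∀ σ, y σ ≤ y' σ + c) :
    logSumExp y ≤ logSumExp y' + c := by
  rw [← Real.exp_le_exp, Real.exp_add, exp_logSumExp, exp_logSumExp, Finset.sum_mul]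
  refine Finset.sum_le_sum fun σ _ => ?_
  rw [← Real.exp_add]
  exact Real.exp_le_exp.2 (h σ)

theorem abs_logSumExp_sub_le {y y' : S → ℝ} {c : ℝ} (h : ∀ σ, |y σ - y' σ| ≤ c) :
    |logSumExp y - logSumExp y'| ≤ c := by
  rw [abs_sub_le_iff]
  constructor
  · have := logSumExp_le_of_le (y := y) (y' := y') (c := c) fun σ => by
      linarith [(abs_sub_le_iff.1 (h σ)).1]
    linarith
  · have := logSumExp_le_of_le (y := y') (y' := y) (c := c) fun σ => by
      linarith [(abs_sub_le_iff.1 (h σ)).2]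
    linarith

theorem continuous_logSumExp : Continuous (logSumExp : (S → ℝ) → ℝ) := by
  unfold logSumExp
  exact Continuous.log (by fun_prop) fun y => (sum_exp_pos y).ne'

theorem continuous_softAverage (f : S → ℝ) : Continuous fun y => softAverage y f := by
  unfold softAverage
  exact Continuous.div (by fun_prop) (by fun_prop) fun y => (sum_exp_pos y).ne'

theorem hasDerivAt_logSumExp {y : ℝ → S → ℝ} {d : S → ℝ} {t : ℝ}
    (h : ∀ σ, HasDerivAt (fun t => y t σ) (d σ) t) :
    HasDerivAt (fun t => logSumExp (y t)) (softAverage (y t) d) t := by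
  have h1 : HasDerivAt (fun t => ∑ σ, Real.exp (y t σ)) (∑ σ, Real.exp (y t σ) * d σ) t :=
    HasDerivAt.fun_sum fun σ _ => (h σ).exp
  have h2 := h1.log (sum_exp_pos (y t)).ne'
  unfold logSumExp softAverage
  simpa only [mul_comm] using h2

theorem hasDerivAt_softAverage {y : ℝ → S → ℝ} {d : S → ℝ} {t : ℝ} (f : S → ℝ)
    (h : ∀ σ, HasDerivAt (fun t => y t σ) (d σ) t) :
    HasDerivAt (fun t => softAverage (y t) f)
      (softAverage (y t) (fun σ => f σ * d σ) - softAverage (y t) f * softAverage (y t) d) t := by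
  have h1 : HasDerivAt (fun t => ∑ σ, Real.exp (y t σ)) (∑ σ, Real.exp (y t σ) * d σ) t :=
    HasDerivAt.fun_sum fun σ _ => (h σ).exp
  have h2 : HasDerivAt (fun t => ∑ σ, f σ * Real.exp (y t σ))
      (∑ σ, f σ * (Real.exp (y t σ) * d σ)) t :=
    HasDerivAt.fun_sum fun σ _ => (h σ).exp.const_mul _
  have h3 := h2.div h1 (sum_exp_pos (y t)).ne'
  refine h3.congr_deriv ?_
  have hz := (sum_exp_pos (y t)).ne'
  have e1 : ∑ σ, f σ * (Real.exp (y t σ) * d σ) = ∑ σ, f σ * d σ * Real.exp (y t σ) :=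
    Finset.sum_congr rfl fun σ _ => by ring
  have e2 : ∑ σ, Real.exp (y t σ) * d σ = ∑ σ, d σ * Real.exp (y t σ) :=
    Finset.sum_congr rfl fun σ _ => by ring
  rw [e1, e2]
  unfold softAverage
  field_simp

end

section

variable {S : Type*} [Fintype S] {ι κ : Type*} [Fintype ι] [Fintype κ]

/-- The Gaussian energies `c σ + ∑ k, z k * A k σ`. -/
def gaussianField (c : S → ℝ) (A : ι → S → ℝ) (z : ι → ℝ) (σ : S) : ℝ := c σ + ∑ k, z k * A k σ

omit [Fintype S] in
theorem continuous_gaussianField (c : S → ℝ) (A : ι → S → ℝ) :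
    Continuous (gaussianField c A) := by
  unfold gaussianField
  fun_prop

/-- The expected log-partition function of Gaussian energies. -/
noncomputable def gaussianLogSumExp (c : S → ℝ) (A : ι → S → ℝ) : ℝ :=
  ∫ z, logSumExp (gaussianField c A z) ∂stdGaussian ι

omit [Fintype S] in
theorem gaussianField_update [DecidableEq ι] (c : S → ℝ) (A : ι → S → ℝ) (z : ι → ℝ) (k : ι)
    (x : ℝ) (σ : S) :
    gaussianField c A (Function.update z k x) σ
      = gaussianField c A (Function.update z k 0) σ + x * A k σ := by
  simp only [gaussianField]
  rw [← Finset.add_sum_erase _ _ (Finset.mem_univ k),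
    ← Finset.add_sum_erase _ (fun j => Function.update z k 0 j * A j σ) (Finset.mem_univ k)]
  have : ∀ y : ℝ, ∑ j ∈ Finset.univ.erase k, Function.update z k y j * A j σ
      = ∑ j ∈ Finset.univ.erase k, z j * A j σ := fun y =>
    Finset.sum_congr rfl fun j hj => by rw [Function.update_of_ne (Finset.ne_of_mem_erase hj)]
  rw [this, this]
  simp
  ring

variable [Nonempty S]

theorem coordLipschitz_logSumExp [DecidableEq ι] (c : S → ℝ) {A : ι → S → ℝ} {a : ι → ℝ}
    (hA : ∀ k σ, |A k σ| ≤ a k) :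
    CoordLipschitz a fun z => logSumExp (gaussianField c A z) := by
  intro z k x y
  refine abs_logSumExp_sub_le fun σ => ?_
  rw [gaussianField_update c A z k x, gaussianField_update c A z k y]
  have : gaussianField c A (Function.update z k 0) σ + x * A k σ
      - (gaussianField c A (Function.update z k 0) σ + y * A k σ) = A k σ * (x - y) := by ring
  rw [this, abs_mul]
  exact mul_le_mul_of_nonneg_right (hA k σ) (abs_nonneg _)

omit [Nonempty S] in
theorem abs_le_sum_abs (f : S → ℝ) (σ : S) : |f σ| ≤ ∑ τ, |f τ| :=
  Finset.single_le_sum (f := fun τ => |f τ|) (fun _ _ => abs_nonneg _) (Finset.mem_univ σ)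

theorem continuous_logSumExp_gaussianField (c : S → ℝ) (A : ι → S → ℝ) :
    Continuous fun z => logSumExp (gaussianField c A z) :=
  continuous_logSumExp.comp (continuous_gaussianField c A)

theorem integrable_logSumExp_gaussianField (c : S → ℝ) (A : ι → S → ℝ) :
    Integrable (fun z => logSumExp (gaussianField c A z)) (stdGaussian ι) := by
  classical
  exact (coordLipschitz_logSumExp c (a := fun k => ∑ τ, |A k τ|)
    fun k σ => abs_le_sum_abs (A k) σ).integrable

/-- Gaussian integration by parts for Gibbs averages. -/
theorem integral_mul_softAverage (c : S → ℝ) (A : ι → S → ℝ) (k : ι) (f : S → ℝ) :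
    ∫ z, z k * softAverage (gaussianField c A z) f ∂stdGaussian ι
      = ∫ z, (softAverage (gaussianField c A z) (fun σ => f σ * A k σ)
        - softAverage (gaussianField c A z) f * softAverage (gaussianField c A z) (A k))
          ∂stdGaussian ι := by
  classical
  have hb := abs_le_sum_abs f
  have hb2 := abs_le_sum_abs (A k)
  have hb3 := abs_le_sum_abs fun σ => f σ * A k σ
  have hcont : ∀ f : S → ℝ, Continuous fun z => softAverage (gaussianField c A z) f := fun f =>
    (continuous_softAverage f).comp (continuous_gaussianField c A)
  refine integral_eval_mul_stdGaussian (C := ∑ τ, |f τ|)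
    (C' := (∑ τ, |f τ * A k τ|) + (∑ τ, |f τ|) * ∑ τ, |A k τ|) k (fun z x => ?_)
    (hcont f).measurable ((hcont _).sub ((hcont _).mul (hcont _))).measurable
    (fun z => abs_softAverage_le _ hb) (fun z => ?_)
  · refine hasDerivAt_softAverage (y := fun x => gaussianField c A (Function.update z k x)) f
      fun σ => ?_
    have hfun : (fun x => gaussianField c A (Function.update z k x) σ) = fun x =>
        gaussianField c A (Function.update z k 0) σ + x * A k σ :=
      funext fun x => gaussianField_update c A z k x σ
    rw [hfun]
    have := ((hasDerivAt_id x).mul_const (A k σ)).const_add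
      (gaussianField c A (Function.update z k 0) σ)
    simpa using this
  · refine (abs_sub _ _).trans (add_le_add (abs_softAverage_le _ hb3) ?_)
    rw [abs_mul]
    exact mul_le_mul (abs_softAverage_le _ hb) (abs_softAverage_le _ hb2) (abs_nonneg _)
      (Finset.sum_nonneg fun _ _ => abs_nonneg _)

/-- Derivative of the expected log-partition function when the couplings are rescaled. -/
theorem hasDerivAt_gaussianLogSumExp (c : S → ℝ) (A : ι → S → ℝ) {u u' : ι → ℝ → ℝ}
    (hu : ∀ k t, HasDerivAt (u k) (u' k t) t) (hu' : ∀ k t, |u' k t| ≤ 1) (t : ℝ) :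
    HasDerivAt (fun t => gaussianLogSumExp c fun k σ => u k t * A k σ)
      (∫ z, ∑ k, u k t * u' k t *
        (softAverage (gaussianField c (fun k σ => u k t * A k σ) z) (fun σ => A k σ * A k σ)
        - softAverage (gaussianField c (fun k σ => u k t * A k σ) z) (A k)
          * softAverage (gaussianField c (fun k σ => u k t * A k σ) z) (A k)) ∂stdGaussian ι) t := by
  set At : ℝ → ι → S → ℝ := fun t k σ => u k t * A k σ with hAt
  have hcont : ∀ t (f : S → ℝ), Continuous fun z => softAverage (gaussianField c (At t) z) f :=
    fun t f => (continuous_softAverage f).comp (continuous_gaussianField c (At t))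
  have hbound : ∀ t (f : S → ℝ) z, |softAverage (gaussianField c (At t) z) f| ≤ ∑ τ, |f τ| :=
    fun t f z => abs_softAverage_le _ (abs_le_sum_abs f)
  have key := hasDerivAt_integral_of_dominated_loc_of_deriv_le (μ := stdGaussian ι) (x₀ := t)
    (F := fun t z => logSumExp (gaussianField c (At t) z))
    (F' := fun t z => ∑ k, u' k t * (z k * softAverage (gaussianField c (At t) z) (A k)))
    (bound := fun z => ∑ k, |z k| * ∑ τ, |A k τ|) (s := univ) univ_mem
    (Eventually.of_forall fun t =>
      (integrable_logSumExp_gaussianField c (At t)).aestronglyMeasurable)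
    (integrable_logSumExp_gaussianField c (At t))
    (by
      refine Continuous.aestronglyMeasurable ?_
      refine continuous_finsetSum _ fun k _ => ?_
      exact continuous_const.mul ((continuous_apply k).mul (hcont t (A k))))
    (ae_of_all _ fun z t _ => by
      rw [Real.norm_eq_abs]
      refine (Finset.abs_sum_le_sum_abs _ _).trans (Finset.sum_le_sum fun k _ => ?_)
      rw [abs_mul, abs_mul]
      calc |u' k t| * (|z k| * |softAverage (gaussianField c (At t) z) (A k)|)
          ≤ 1 * (|z k| * ∑ τ, |A k τ|) := by
            gcongr
            · exact hu' k t
            · exact hbound t (A k) z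
        _ = _ := one_mul _)
    (integrable_finsetSum _ fun k _ => (integrable_eval_stdGaussian k).abs.mul_const _)
    (ae_of_all _ fun z t _ => by
      have h1 := hasDerivAt_logSumExp (y := fun t => gaussianField c (At t) z)
        (d := fun σ => ∑ k, u' k t * z k * A k σ) (t := t) fun σ => by
          refine HasDerivAt.const_add _ (HasDerivAt.fun_sum fun k _ => ?_)
          refine (((hu k t).mul_const (A k σ)).const_mul (z k)).congr_deriv ?_
          ring
      refine h1.congr_deriv ?_
      rw [softAverage_sum]
      refine Finset.sum_congr rfl fun k _ => ?_
      rw [softAverage_const_mul]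
      ring)
  refine key.2.congr_deriv ?_
  have hi : ∀ k, Integrable (fun z : ι → ℝ => z k * softAverage (gaussianField c (At t) z) (A k))
      (stdGaussian ι) := fun k =>
    (integrable_eval_stdGaussian k).mul_bdd (hcont t (A k)).aestronglyMeasurable
      (ae_of_all _ (hbound t (A k)))
  have hi2 : ∀ k, Integrable (fun z : ι → ℝ =>
      softAverage (gaussianField c (At t) z) (fun σ => A k σ * A k σ)
        - softAverage (gaussianField c (At t) z) (A k)
          * softAverage (gaussianField c (At t) z) (A k)) (stdGaussian ι) := fun k => by
    refine (Integrable.of_bound (hcont t _).aestronglyMeasurable _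
      (ae_of_all _ (hbound t _))).sub ?_
    refine (Integrable.of_bound (hcont t (A k)).aestronglyMeasurable _
      (ae_of_all _ (hbound t _))).mul_bdd (hcont t (A k)).aestronglyMeasurable
      (ae_of_all _ (hbound t _))
  rw [integral_finsetSum _ fun k _ => (hi k).const_mul _,
    integral_finsetSum _ fun k _ => (hi2 k).const_mul _]
  refine Finset.sum_congr rfl fun k _ => ?_
  rw [integral_const_mul, integral_const_mul, integral_mul_softAverage, ← integral_const_mul,
    ← integral_const_mul]
  congr 1
  ext z
  have e1 : softAverage (gaussianField c (At t) z) (fun σ => A k σ * At t k σ)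
      = u k t * softAverage (gaussianField c (At t) z) (fun σ => A k σ * A k σ) := by
    rw [← softAverage_const_mul]
    congr 1
    ext σ
    simp only [hAt]
    ring
  have e2 : softAverage (gaussianField c (At t) z) (At t k)
      = u k t * softAverage (gaussianField c (At t) z) (A k) := by
    rw [← softAverage_const_mul]
  rw [e1, e2]
  ring

theorem sum_softAverage_sub_sq (y : S → ℝ) (A : ι → S → ℝ) :
    ∑ k, (softAverage y (fun σ => A k σ * A k σ) - softAverage y (A k) * softAverage y (A k))
      = softAverage y fun σ => softAverage y fun τ =>
        (∑ k, A k σ * A k σ) - ∑ k, A k σ * A k τ := by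
  have h1 : ∀ σ, softAverage y (fun τ => (∑ k, A k σ * A k σ) - ∑ k, A k σ * A k τ)
      = (∑ k, A k σ * A k σ) - ∑ k, softAverage y (A k) * A k σ := fun σ => by
    rw [softAverage_sub, softAverage_const, softAverage_sum]
    congr 1
    refine Finset.sum_congr rfl fun k _ => ?_
    rw [softAverage_const_mul, mul_comm]
  simp only [h1]
  rw [softAverage_sub, softAverage_sum, softAverage_sum, ← Finset.sum_sub_distrib]
  refine Finset.sum_congr rfl fun k _ => ?_
  rw [softAverage_const_mul]

theorem measurePreserving_inl_stdGaussian :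
    MeasurePreserving (fun (z : ι ⊕ κ → ℝ) k => z (Sum.inl k)) (stdGaussian (ι ⊕ κ))
      (stdGaussian ι) :=
  measurePreserving_fst.comp
    (measurePreserving_sumPiEquivProdPi fun _ : ι ⊕ κ => gaussianReal 0 1)

theorem measurePreserving_inr_stdGaussian :
    MeasurePreserving (fun (z : ι ⊕ κ → ℝ) k => z (Sum.inr k)) (stdGaussian (ι ⊕ κ))
      (stdGaussian κ) :=
  measurePreserving_snd.comp
    (measurePreserving_sumPiEquivProdPi fun _ : ι ⊕ κ => gaussianReal 0 1)

theorem integral_comp_inl_stdGaussian {f : (ι → ℝ) → ℝ} (hf : Continuous f) :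
    ∫ z : ι ⊕ κ → ℝ, f (fun k => z (Sum.inl k)) ∂stdGaussian (ι ⊕ κ) = ∫ z, f z ∂stdGaussian ι := by
  have h := measurePreserving_inl_stdGaussian (ι := ι) (κ := κ)
  rw [← h.map_eq, integral_map h.measurable.aemeasurable hf.aestronglyMeasurable]

theorem integral_comp_inr_stdGaussian {f : (κ → ℝ) → ℝ} (hf : Continuous f) :
    ∫ z : ι ⊕ κ → ℝ, f (fun k => z (Sum.inr k)) ∂stdGaussian (ι ⊕ κ) = ∫ z, f z ∂stdGaussian κ := by
  have h := measurePreserving_inr_stdGaussian (ι := ι) (κ := κ)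
  rw [← h.map_eq, integral_map h.measurable.aemeasurable hf.aestronglyMeasurable]

/-- Slepian-type comparison of expected log-partition functions, by Gaussian interpolation. -/
theorem gaussianLogSumExp_le_of_covariance_le (c : S → ℝ) (A : ι → S → ℝ) (A' : κ → S → ℝ)
    (hdiag : ∀ σ, ∑ k, A k σ * A k σ = ∑ k, A' k σ * A' k σ)
    (hle : ∀ σ τ, ∑ k, A k σ * A k τ ≤ ∑ k, A' k σ * A' k τ) :
    gaussianLogSumExp c A' ≤ gaussianLogSumExp c A := by
  set AA : ι ⊕ κ → S → ℝ := Sum.elim A A' with hAA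
  set u : ι ⊕ κ → ℝ → ℝ := Sum.elim (fun _ => Real.cos) (fun _ => Real.sin) with hu
  set u' : ι ⊕ κ → ℝ → ℝ := Sum.elim (fun _ t => -Real.sin t) (fun _ => Real.cos) with hu'
  have hd : ∀ k t, HasDerivAt (u k) (u' k t) t := by
    rintro (k | k) t
    · exact Real.hasDerivAt_cos t
    · exact Real.hasDerivAt_sin t
  have hb : ∀ k t, |u' k t| ≤ 1 := by
    rintro (k | k) t
    · simpa [hu'] using Real.abs_sin_le_one t
    · simpa [hu'] using Real.abs_cos_le_one t
  have hderiv := hasDerivAt_gaussianLogSumExp c AA hd hb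
  set Φ : ℝ → ℝ := fun t => gaussianLogSumExp c fun k σ => u k t * AA k σ with hΦ
  have hΦ0 : Φ 0 = gaussianLogSumExp c A := by
    simp only [hΦ, gaussianLogSumExp]
    rw [← integral_comp_inl_stdGaussian (κ := κ)
      (continuous_logSumExp_gaussianField c A)]
    congr 1
    ext z
    congr 1
    ext σ
    simp [gaussianField, hu, hAA]
  have hΦ1 : Φ (Real.pi / 2) = gaussianLogSumExp c A' := by
    simp only [hΦ, gaussianLogSumExp]
    rw [← integral_comp_inr_stdGaussian (ι := ι)
      (continuous_logSumExp_gaussianField c A')]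
    congr 1
    ext z
    congr 1
    ext σ
    simp [gaussianField, hu, hAA]
  have hanti : AntitoneOn Φ (Icc 0 (Real.pi / 2)) := by
    refine antitoneOn_of_deriv_nonpos (convex_Icc _ _)
      (fun t _ => (hderiv t).continuousAt.continuousWithinAt)
      (fun t _ => (hderiv t).differentiableAt.differentiableWithinAt) fun t ht => ?_
    rw [interior_Icc] at ht
    rw [(hderiv t).deriv]
    refine integral_nonpos fun z => ?_
    simp only [Pi.zero_apply]
    set y := gaussianField c (fun k σ => u k t * AA k σ) z
    rw [Fintype.sum_sum_type]
    simp only [hu, hu', hAA, Sum.elim_inl, Sum.elim_inr]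
    rw [← Finset.mul_sum, ← Finset.mul_sum, sum_softAverage_sub_sq, sum_softAverage_sub_sq]
    have hle' : softAverage y (fun σ => softAverage y fun τ =>
          (∑ k, A' k σ * A' k σ) - ∑ k, A' k σ * A' k τ)
        ≤ softAverage y (fun σ => softAverage y fun τ =>
          (∑ k, A k σ * A k σ) - ∑ k, A k σ * A k τ) := by
      refine softAverage_mono y fun σ => softAverage_mono y fun τ => ?_
      linarith [hdiag σ, hle σ τ]
    have hcs : 0 ≤ Real.cos t * Real.sin t :=
      mul_nonneg (Real.cos_nonneg_of_mem_Icc ⟨by linarith [ht.1, Real.pi_pos], ht.2.le⟩)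
        (Real.sin_nonneg_of_mem_Icc ⟨ht.1.le, by linarith [ht.2, Real.pi_pos]⟩)
    nlinarith [mul_le_mul_of_nonneg_left hle' hcs]
  rw [← hΦ0, ← hΦ1]
  have hpi : (0 : ℝ) ≤ Real.pi / 2 := by positivity
  exact hanti ⟨le_rfl, hpi⟩ ⟨hpi, le_rfl⟩ hpi

theorem logSumExp_prod {S' : Type*} [Fintype S'] [Nonempty S'] (y : S → ℝ) (y' : S' → ℝ) :
    logSumExp (fun σ : S × S' => y σ.1 + y' σ.2) = logSumExp y + logSumExp y' := by
  unfold logSumExp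
  rw [← Real.log_mul (sum_exp_pos y).ne' (sum_exp_pos y').ne', Finset.sum_mul_sum,
    Fintype.sum_prod_type]
  simp only [Real.exp_add]

theorem gaussianLogSumExp_prod {S' : Type*} [Fintype S'] [Nonempty S'] (c : S → ℝ) (c' : S' → ℝ)
    (A : ι → S → ℝ) (A' : κ → S' → ℝ) :
    gaussianLogSumExp (fun σ : S × S' => c σ.1 + c' σ.2)
      (Sum.elim (fun k σ => A k σ.1) (fun k σ => A' k σ.2))
      = gaussianLogSumExp c A + gaussianLogSumExp c' A' := by
  unfold gaussianLogSumExp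
  have e : ∀ z : ι ⊕ κ → ℝ, logSumExp (gaussianField (fun σ : S × S' => c σ.1 + c' σ.2)
      (Sum.elim (fun k σ => A k σ.1) (fun k σ => A' k σ.2)) z)
      = logSumExp (gaussianField c A fun k => z (Sum.inl k))
        + logSumExp (gaussianField c' A' fun k => z (Sum.inr k)) := fun z => by
    rw [← logSumExp_prod]
    congr 1
    ext σ
    simp only [gaussianField, Fintype.sum_sum_type, Sum.elim_inl, Sum.elim_inr]
    ring
  have i1 : Integrable (fun z : ι ⊕ κ → ℝ => logSumExp (gaussianField c A fun k => z (Sum.inl k)))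
      (stdGaussian (ι ⊕ κ)) := measurePreserving_inl_stdGaussian.integrable_comp_of_integrable
    (integrable_logSumExp_gaussianField c A)
  have i2 : Integrable (fun z : ι ⊕ κ → ℝ => logSumExp (gaussianField c' A' fun k => z (Sum.inr k)))
      (stdGaussian (ι ⊕ κ)) := measurePreserving_inr_stdGaussian.integrable_comp_of_integrable
    (integrable_logSumExp_gaussianField c' A')
  simp only [e]
  rw [integral_add i1 i2, ← integral_comp_inl_stdGaussian (κ := κ)
    (continuous_logSumExp_gaussianField c A), ← integral_comp_inr_stdGaussian (ι := ι)
    (continuous_logSumExp_gaussianField c' A')]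

omit [Nonempty S] in
theorem gaussianLogSumExp_equiv {S' : Type*} [Fintype S'] (e : S' ≃ S) (c : S → ℝ)
    (A : ι → S → ℝ) :
    gaussianLogSumExp (fun σ => c (e σ)) (fun k σ => A k (e σ)) = gaussianLogSumExp c A := by
  unfold gaussianLogSumExp
  congr 1
  ext z
  unfold logSumExp
  rw [← e.sum_comp]
  rfl

/-- Jensen's inequality: the annealed bound. -/
theorem gaussianLogSumExp_le (c : S → ℝ) (A : ι → S → ℝ) :
    gaussianLogSumExp c A ≤ logSumExp fun σ => c σ + (∑ k, A k σ ^ 2) / 2 := by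
  set T := ∑ σ, Real.exp (c σ + (∑ k, A k σ ^ 2) / 2) with hT
  have hTpos : 0 < T := sum_exp_pos _
  have hfac : ∀ σ, (fun z => Real.exp (gaussianField c A z σ))
      = fun z => Real.exp (c σ) * ∏ k, Real.exp (A k σ * z k) := fun σ => by
    ext z
    rw [gaussianField, Real.exp_add, Real.exp_sum]
    simp only [mul_comm]
  have hint : ∀ σ, Integrable (fun z => Real.exp (gaussianField c A z σ)) (stdGaussian ι) := by
    intro σ
    rw [hfac]
    refine Integrable.const_mul ?_ _
    exact Integrable.fintype_prod (f := fun k x => Real.exp (A k σ * x)) fun k =>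
      integrable_exp_mul_gaussianReal (μ := 0) (v := 1) _
  have hval : ∀ σ, ∫ z, Real.exp (gaussianField c A z σ) ∂stdGaussian ι
      = Real.exp (c σ + (∑ k, A k σ ^ 2) / 2) := by
    intro σ
    rw [hfac, integral_const_mul, stdGaussian,
      integral_fintype_prod_eq_prod (f := fun k x => Real.exp (A k σ * x))]
    have hm : ∀ t : ℝ, ∫ x, Real.exp (t * x) ∂gaussianReal 0 1 = Real.exp (t ^ 2 / 2) := fun t => by
      have := mgf_gaussianReal (p := gaussianReal 0 1) (X := id) (μ := 0) (v := 1) (by simp) t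
      simpa [mgf] using this
    simp only [hm]
    rw [← Real.exp_sum, ← Real.exp_add, Finset.sum_div]
  have hlog : ∀ z, logSumExp (gaussianField c A z)
      ≤ (∑ σ, Real.exp (gaussianField c A z σ)) / T - 1 + Real.log T := fun z => by
    have h1 := Real.log_le_sub_one_of_pos (div_pos (sum_exp_pos (gaussianField c A z)) hTpos)
    rw [Real.log_div (sum_exp_pos _).ne' hTpos.ne'] at h1
    unfold logSumExp
    linarith
  have hsi : Integrable (fun z => (∑ σ, Real.exp (gaussianField c A z σ)) / T) (stdGaussian ι) :=
    (integrable_finsetSum _ fun σ _ => hint σ).div_const T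
  have h2 := integral_mono (integrable_logSumExp_gaussianField c A)
    ((hsi.sub (integrable_const 1)).add (integrable_const (Real.log T))) hlog
  refine h2.trans (le_of_eq ?_)
  rw [integral_add' (hsi.sub (integrable_const 1)) (integrable_const _),
    integral_sub' hsi (integrable_const 1), integral_div, integral_finsetSum _ fun σ _ => hint σ]
  simp only [hval, ← hT]
  rw [div_self hTpos.ne']
  simp [logSumExp, hT]

end

theorem abs_spin {N : ℕ} (σ : Config N) (i : Fin N) : |spin σ i| = 1 := by
  rcases Int.units_eq_one_or (σ i) with h | h <;> simp [spin, h]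

theorem spin_mul_self {N : ℕ} (σ : Config N) (i : Fin N) : spin σ i * spin σ i = 1 := by
  rw [← abs_mul_abs_self, abs_spin, one_mul]

theorem abs_prod_spin {N n : ℕ} (σ : Config N) (i : Fin n → Fin N) :
    |∏ j, spin σ (i j)| = 1 := by
  rw [Finset.abs_prod]
  exact Finset.prod_eq_one fun j _ => abs_spin σ (i j)

/-- The coefficient of the `2p`-spin interaction. -/
noncomputable def couplingCoeff (B : ℕ+ → ℝ) (N : ℕ) (p : ℕ+) : ℝ :=
  B p / (N : ℝ) ^ (((p : ℕ) : ℝ) - 1 / 2)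

theorem couplingCoeff_sq (B : ℕ+ → ℝ) {N : ℕ} (hN : N ≠ 0) (p : ℕ+) :
    couplingCoeff B N p ^ 2 = B p ^ 2 * (N / (N : ℝ) ^ (2 * (p : ℕ))) := by
  have hN' : (0 : ℝ) < N := by positivity
  have h : ((N : ℝ) ^ (((p : ℕ) : ℝ) - 1 / 2)) ^ 2 = (N : ℝ) ^ (2 * (p : ℕ)) / N := by
    rw [← Real.rpow_natCast, ← Real.rpow_mul hN'.le, ← Real.rpow_natCast (N : ℝ) (2 * (p : ℕ)),
      eq_div_iff hN'.ne']
    conv_lhs => rw [← Real.rpow_one (N : ℝ)]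
    rw [Real.rpow_one, ← Real.rpow_add_one hN'.ne']
    congr 1
    push_cast
    ring
  rw [couplingCoeff, div_pow, h, div_div_eq_mul_div, mul_div_assoc]

/-- Indices of the couplings with `p ∈ s`. -/
abbrev TruncIndex (s : Finset ℕ+) (N : ℕ) : Type := Σ p : s, (Fin (2 * ((p : ℕ+) : ℕ)) → Fin N)

/-- The vectors whose Gaussian combination is the truncated Hamiltonian with centered field. -/
noncomputable def truncVector (B : ℕ+ → ℝ) (v : ℝ≥0) (s : Finset ℕ+) (N : ℕ) :
    TruncIndex s N ⊕ Fin N → Config N → ℝ :=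
  Sum.elim (fun k σ => couplingCoeff B N k.1 * ∏ j, spin σ (k.2 j)) (fun i σ => √v * spin σ i)

/-- The energy of a constant external field. -/
noncomputable def constantField (x : ℝ) {N : ℕ} (σ : Config N) : ℝ := ∑ i, x * spin σ i

/-- The unnormalized overlap of two configurations. -/
noncomputable def overlapSum {N : ℕ} (σ τ : Config N) : ℝ := ∑ i, spin σ i * spin τ i

theorem overlapSum_self {N : ℕ} (σ : Config N) : overlapSum σ σ = N := by
  simp [overlapSum, spin_mul_self]

theorem sum_truncVector_mul (B : ℕ+ → ℝ) (v : ℝ≥0) (s : Finset ℕ+) {N : ℕ} (hN : N ≠ 0)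
    (σ τ : Config N) :
    ∑ k, truncVector B v s N k σ * truncVector B v s N k τ
      = (∑ p ∈ s, B p ^ 2 * (N * (overlapSum σ τ / N) ^ (2 * (p : ℕ)))) + v * overlapSum σ τ := by
  rw [Fintype.sum_sum_type, Fintype.sum_sigma]
  congr 1
  · rw [← Finset.sum_coe_sort s fun p : ℕ+ =>
      B p ^ 2 * (N * (overlapSum σ τ / N) ^ (2 * (p : ℕ)))]
    refine Finset.sum_congr rfl fun p _ => ?_
    simp only [truncVector, Sum.elim_inl]
    have : ∀ i : Fin (2 * ((p : ℕ+) : ℕ)) → Fin N,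
        (couplingCoeff B N p * ∏ j, spin σ (i j)) * (couplingCoeff B N p * ∏ j, spin τ (i j))
        = couplingCoeff B N p ^ 2 * ∏ j, (spin σ (i j) * spin τ (i j)) := fun i => by
      rw [Finset.prod_mul_distrib]
      ring
    simp only [this]
    rw [← Finset.mul_sum, ← Fintype.sum_pow (fun a => spin σ a * spin τ a), couplingCoeff_sq B hN,
      div_pow, overlapSum]
    ring
  · simp only [truncVector, Sum.elim_inr, overlapSum, Finset.mul_sum]
    refine Finset.sum_congr rfl fun i _ => ?_
    have := Real.mul_self_sqrt v.coe_nonneg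
    linear_combination spin σ i * spin τ i * this

theorem sum_truncVector_sq (B : ℕ+ → ℝ) (v : ℝ≥0) (s : Finset ℕ+) {N : ℕ} (hN : N ≠ 0)
    (σ : Config N) :
    ∑ k, truncVector B v s N k σ ^ 2 = N * ((∑ p ∈ s, B p ^ 2) + v) := by
  simp only [sq (truncVector _ _ _ _ _ _)]
  rw [sum_truncVector_mul B v s hN, overlapSum_self, div_self (by positivity)]
  simp only [one_pow, mul_one]
  rw [← Finset.sum_mul]
  ring

/-- The expected log-partition function of the truncated model in the external field
`N(x, v)`. -/
noncomputable def truncPressure (B : ℕ+ → ℝ) (v : ℝ≥0) (s : Finset ℕ+) (x : ℝ) (N : ℕ) : ℝ :=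
  gaussianLogSumExp (constantField x) (truncVector B v s N)

theorem mul_div_pow_le_of_even {m n : ℕ} (hm : m ≠ 0) (hn : n ≠ 0) (p : ℕ) (x y : ℝ) :
    ((m + n : ℕ) : ℝ) * ((x + y) / ((m + n : ℕ) : ℝ)) ^ (2 * p)
      ≤ m * (x / m) ^ (2 * p) + n * (y / n) ^ (2 * p) := by
  have hm' : (0 : ℝ) < m := by positivity
  have hn' : (0 : ℝ) < n := by positivity
  have hmn : (0 : ℝ) < m + n := by positivity
  have hc := (even_two_mul p).convexOn_pow (𝕜 := ℝ)
  have h := hc.2 (mem_univ (x / m)) (mem_univ (y / n)) (div_nonneg hm'.le hmn.le)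
    (div_nonneg hn'.le hmn.le) (by field_simp)
  simp only [smul_eq_mul] at h
  have e : (m : ℝ) / (m + n) * (x / m) + n / (m + n) * (y / n) = (x + y) / (m + n) := by
    field_simp
  rw [e] at h
  push_cast
  calc ((m : ℝ) + n) * ((x + y) / (m + n)) ^ (2 * p)
      ≤ (m + n) * (m / (m + n) * (x / m) ^ (2 * p) + n / (m + n) * (y / n) ^ (2 * p)) :=
        mul_le_mul_of_nonneg_left h hmn.le
    _ = _ := by field_simp

theorem spin_append_castAdd {m n : ℕ} (σ : Config m × Config n) (i : Fin m) :
    spin (Fin.appendEquiv m n σ) (Fin.castAdd n i) = spin σ.1 i := by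
  simp [spin, Fin.appendEquiv]

theorem spin_append_natAdd {m n : ℕ} (σ : Config m × Config n) (i : Fin n) :
    spin (Fin.appendEquiv m n σ) (Fin.natAdd m i) = spin σ.2 i := by
  simp [spin, Fin.appendEquiv]

theorem overlapSum_append {m n : ℕ} (σ τ : Config m × Config n) :
    overlapSum (Fin.appendEquiv m n σ) (Fin.appendEquiv m n τ)
      = overlapSum σ.1 τ.1 + overlapSum σ.2 τ.2 := by
  simp only [overlapSum, Fin.sum_univ_add, spin_append_castAdd, spin_append_natAdd]

theorem constantField_append (x : ℝ) {m n : ℕ} (σ : Config m × Config n) :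
    constantField x (Fin.appendEquiv m n σ) = constantField x σ.1 + constantField x σ.2 := by
  simp only [constantField, Fin.sum_univ_add, spin_append_castAdd, spin_append_natAdd]

/-- Guerra-Toninelli superadditivity. -/
theorem truncPressure_add_le (B : ℕ+ → ℝ) (v : ℝ≥0) (s : Finset ℕ+) (x : ℝ) {m n : ℕ}
    (hm : m ≠ 0) (hn : n ≠ 0) :
    truncPressure B v s x m + truncPressure B v s x n ≤ truncPressure B v s x (m + n) := by
  have hmn : m + n ≠ 0 := by omega
  have hcov : ∀ σ τ : Config m × Config n,
      ∑ k : (TruncIndex s m ⊕ Fin m) ⊕ (TruncIndex s n ⊕ Fin n),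
        (Sum.elim (fun k σ => truncVector B v s m k σ.1) (fun k σ => truncVector B v s n k σ.2) :
          _ → Config m × Config n → ℝ) k σ
        * (Sum.elim (fun k σ => truncVector B v s m k σ.1)
          (fun k σ => truncVector B v s n k σ.2) : _ → Config m × Config n → ℝ) k τ
      = ((∑ p ∈ s, B p ^ 2 * (m * (overlapSum σ.1 τ.1 / m) ^ (2 * (p : ℕ))))
          + v * overlapSum σ.1 τ.1)
        + ((∑ p ∈ s, B p ^ 2 * (n * (overlapSum σ.2 τ.2 / n) ^ (2 * (p : ℕ))))
          + v * overlapSum σ.2 τ.2) := by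
    intro σ τ
    rw [Fintype.sum_sum_type, ← sum_truncVector_mul B v s hm, ← sum_truncVector_mul B v s hn]
    rfl
  unfold truncPressure
  rw [← gaussianLogSumExp_equiv (Fin.appendEquiv m n), ← gaussianLogSumExp_prod]
  simp only [constantField_append]
  refine gaussianLogSumExp_le_of_covariance_le _ _ _ (fun σ => ?_) fun σ τ => ?_
  · rw [hcov, sum_truncVector_mul B v s hmn, overlapSum_append]
    simp only [overlapSum_self]
    have h1 : ((m : ℝ) + n) / ((m + n : ℕ) : ℝ) = 1 := by
      push_cast
      exact div_self (by positivity)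
    have h2 : (m : ℝ) / m = 1 := div_self (by positivity)
    have h3 : (n : ℝ) / n = 1 := div_self (by positivity)
    rw [h1, h2, h3]
    simp only [one_pow, mul_one]
    rw [← Finset.sum_mul, ← Finset.sum_mul, ← Finset.sum_mul]
    push_cast
    ring
  · rw [hcov, sum_truncVector_mul B v s hmn, overlapSum_append]
    have : ∑ p ∈ s, B p ^ 2 * (((m + n : ℕ) : ℝ) *
          ((overlapSum σ.1 τ.1 + overlapSum σ.2 τ.2) / ((m + n : ℕ) : ℝ)) ^ (2 * (p : ℕ)))
        ≤ (∑ p ∈ s, B p ^ 2 * (m * (overlapSum σ.1 τ.1 / m) ^ (2 * (p : ℕ))))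
          + ∑ p ∈ s, B p ^ 2 * (n * (overlapSum σ.2 τ.2 / n) ^ (2 * (p : ℕ))) := by
      rw [← Finset.sum_add_distrib]
      refine Finset.sum_le_sum fun p _ => ?_
      rw [← mul_add]
      exact mul_le_mul_of_nonneg_left (mul_div_pow_le_of_even hm hn p _ _) (sq_nonneg _)
    linarith

theorem abs_constantField_le (x : ℝ) {N : ℕ} (σ : Config N) : |constantField x σ| ≤ N * |x| := by
  unfold constantField
  refine (Finset.abs_sum_le_sum_abs _ _).trans ?_
  simp [abs_mul, abs_spin]

theorem logSumExp_zero_config (N : ℕ) : logSumExp (fun _ : Config N => 0) = N * Real.log 2 := by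
  simp [logSumExp]

theorem truncPressure_le (B : ℕ+ → ℝ) (v : ℝ≥0) (s : Finset ℕ+) (x : ℝ) {N : ℕ} (hN : N ≠ 0) :
    truncPressure B v s x N ≤ N * (Real.log 2 + |x| + ((∑ p ∈ s, B p ^ 2) + v) / 2) := by
  refine (gaussianLogSumExp_le _ _).trans ?_
  have h := logSumExp_le_of_le (y := fun σ : Config N => constantField x σ
      + (∑ k, truncVector B v s N k σ ^ 2) / 2) (y' := fun _ => 0)
    (c := N * |x| + N * ((∑ p ∈ s, B p ^ 2) + v) / 2) fun σ => by
      rw [sum_truncVector_sq B v s hN, zero_add]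
      gcongr
      exact (le_abs_self _).trans (abs_constantField_le x σ)
  rw [logSumExp_zero_config] at h
  refine h.trans (le_of_eq ?_)
  ring

/-- Lipschitz constants of the truncated log-partition function in each Gaussian variable. -/
noncomputable def truncLipschitz (B : ℕ+ → ℝ) (v : ℝ≥0) (s : Finset ℕ+) (N : ℕ) :
    TruncIndex s N ⊕ Fin N → ℝ :=
  Sum.elim (fun k => |couplingCoeff B N k.1|) (fun _ => √v)

theorem abs_truncVector (B : ℕ+ → ℝ) (v : ℝ≥0) (s : Finset ℕ+) (N : ℕ)
    (k : TruncIndex s N ⊕ Fin N) (σ : Config N) :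
    |truncVector B v s N k σ| = truncLipschitz B v s N k := by
  rcases k with k | i
  · simp [truncVector, truncLipschitz, abs_mul, abs_prod_spin]
  · simp [truncVector, truncLipschitz, abs_mul, abs_spin, abs_of_nonneg (Real.sqrt_nonneg _)]

theorem sum_truncLipschitz_sq (B : ℕ+ → ℝ) (v : ℝ≥0) (s : Finset ℕ+) {N : ℕ} (hN : N ≠ 0) :
    ∑ k, truncLipschitz B v s N k ^ 2 = N * ((∑ p ∈ s, B p ^ 2) + v) := by
  rw [← sum_truncVector_sq B v s hN 1]
  refine Finset.sum_congr rfl fun k _ => ?_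
  rw [← abs_truncVector B v s N k 1, sq_abs]

/-- Concentration of the truncated log-partition function. -/
theorem lintegral_exp_truncPressure_le (B : ℕ+ → ℝ) (v : ℝ≥0) (s : Finset ℕ+) (x : ℝ) {N : ℕ}
    (hN : N ≠ 0) (t : ℝ) :
    ∫⁻ z, ENNReal.ofReal (Real.exp (t * (logSumExp (gaussianField (constantField x)
        (truncVector B v s N) z) - truncPressure B v s x N))) ∂stdGaussian _
      ≤ ENNReal.ofReal (Real.exp (t ^ 2 * (N * ((∑ p ∈ s, B p ^ 2) + v)))) := by
  classical
  rw [← sum_truncLipschitz_sq B v s hN]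
  exact (coordLipschitz_logSumExp (constantField x) fun k σ =>
    (abs_truncVector B v s N k σ).le).lintegral_exp_le t

theorem ae_summable_abs_and_integrable_tsum {Ω ι : Type*} [MeasurableSpace Ω] {P : Measure Ω}
    [Countable ι] {F : ι → Ω → ℝ} (hF : ∀ i, Integrable (F i) P)
    (hs : Summable fun i => ∫ ω, |F i ω| ∂P) :
    (∀ᵐ ω ∂P, Summable fun i => |F i ω|) ∧ Integrable (fun ω => ∑' i, |F i ω|) P := by
  have hfin : ∫⁻ ω, ∑' i, ‖F i ω‖ₑ ∂P ≠ ⊤ := by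
    rw [lintegral_tsum fun i => (hF i).aestronglyMeasurable.enorm]
    have : ∀ i, ∫⁻ ω, ‖F i ω‖ₑ ∂P = ENNReal.ofReal (∫ ω, |F i ω| ∂P) := fun i =>
      (ofReal_integral_norm_eq_lintegral_enorm (hF i)).symm
    simp only [this]
    rw [← ENNReal.ofReal_tsum_of_nonneg (fun i => integral_nonneg fun ω => abs_nonneg _) hs]
    exact ENNReal.ofReal_ne_top
  have hae : ∀ᵐ ω ∂P, Summable fun i => |F i ω| := by
    filter_upwards [ae_lt_top' (AEMeasurable.tsum fun i => (hF i).aestronglyMeasurable.enorm) hfin]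
      with ω hω
    exact tsum_enorm_ne_top_iff_summable_norm.1 hω.ne
  refine ⟨hae, ?_, ?_⟩
  · exact (AEMeasurable.tsum fun i => (hF i).abs.aestronglyMeasurable.aemeasurable).aestronglyMeasurable
  · refine lt_of_le_of_lt (lintegral_mono_ae ?_) hfin.lt_top
    filter_upwards [hae] with ω hω
    rw [Real.enorm_of_nonneg (tsum_nonneg fun i => abs_nonneg _),
      ENNReal.ofReal_tsum_of_nonneg (fun i => abs_nonneg _) hω]
    exact ENNReal.tsum_le_tsum fun i => by rw [Real.enorm_eq_ofReal_abs]

section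

variable {B : ℕ+ → ℝ}

theorem summable_abs_of_summable_two_pow (hB : Summable fun p : ℕ+ => (2 : ℝ) ^ (p : ℕ) * B p ^ 2) :
    Summable fun p => |B p| := by
  have h2 : Summable fun p : ℕ+ => ((1 : ℝ) / 2) ^ (p : ℕ) :=
    summable_geometric_two.comp_injective PNat.coe_injective
  refine Summable.of_nonneg_of_le (fun p => abs_nonneg _) (fun p => ?_) (hB.add h2)
  have hpos : (0 : ℝ) < 2 ^ (p : ℕ) := by positivity
  rw [one_div, inv_pow, ← sq_abs (B p)]
  set X : ℝ := 2 ^ (p : ℕ)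
  have h3 : X * |B p| ^ 2 + X⁻¹ - |B p| = X⁻¹ * ((X * |B p| - 1 / 2) ^ 2 + 3 / 4) := by
    field_simp
    ring
  have h4 : 0 ≤ X⁻¹ * ((X * |B p| - 1 / 2) ^ 2 + 3 / 4) := by positivity
  linarith

theorem summable_sq_of_summable_two_pow (hB : Summable fun p : ℕ+ => (2 : ℝ) ^ (p : ℕ) * B p ^ 2) :
    Summable fun p => B p ^ 2 := by
  refine Summable.of_nonneg_of_le (fun p => sq_nonneg _) (fun p => ?_) hB
  have : (1 : ℝ) ≤ 2 ^ (p : ℕ) := one_le_pow₀ (by norm_num)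
  nlinarith [sq_nonneg (B p)]

end

section

variable {Ω : Type*} [MeasurableSpace Ω] {P : Measure Ω} {a : ℝ} {v : ℝ≥0} {N : ℕ}
  {g : CouplingIndex N → Ω → ℝ} {h : Fin N → Ω → ℝ} (B : ℕ+ → ℝ)

/-- The `2p`-spin part of the Hamiltonian. -/
noncomputable def pureHamiltonian (g : CouplingIndex N → ℝ) (p : ℕ+) (σ : Config N) : ℝ :=
  couplingCoeff B N p * ∑ i : Fin (2 * (p : ℕ)) → Fin N, g ⟨p, i⟩ * ∏ j, spin σ (i j)

/-- The energies of the truncated model with external field `h`. -/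
noncomputable def truncEnergy (s : Finset ℕ+) (g : CouplingIndex N → ℝ) (h : Fin N → ℝ)
    (σ : Config N) : ℝ :=
  ∑ p ∈ s, pureHamiltonian B g p σ + ∑ i, h i * spin σ i

/-- The energies of the full model with external field `h` and no ferromagnetic interaction. -/
noncomputable def energySK (g : CouplingIndex N → ℝ) (h : Fin N → ℝ) (σ : Config N) : ℝ :=
  hamiltonianSK B g σ + ∑ i, h i * spin σ i

theorem log_partitionFunction_zero (g : CouplingIndex N → ℝ) (h : Fin N → ℝ) :
    Real.log (partitionFunction 0 B g h) = logSumExp (energySK B g h) := by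
  simp [partitionFunction, hamiltonian, logSumExp, energySK]

theorem gaussianReal_map_affine (a : ℝ) (v : ℝ≥0) :
    (gaussianReal 0 1).map (fun x => √v * x + a) = gaussianReal a v := by
  have h1 : (fun x : ℝ => √v * x + a) = (fun x => x + a) ∘ fun x => √v * x := rfl
  rw [h1, ← Measure.map_map (by fun_prop) (by fun_prop), gaussianReal_map_const_mul,
    gaussianReal_map_add_const]
  congr 1
  · simp
  · ext
    simp

variable {B}

theorem IsDisorder.hasLaw_truncEnergy (hd : IsDisorder P a v g h) (s : Finset ℕ+) (x : ℝ) :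
    HasLaw (fun ω => truncEnergy B s (fun k => g k ω) (fun i => x + h i ω))
      ((stdGaussian (TruncIndex s N ⊕ Fin N)).map
        (gaussianField (constantField (x + a)) (truncVector B v s N))) P := by
  set emb : TruncIndex s N ⊕ Fin N → CouplingIndex N ⊕ Fin N :=
    Sum.map (fun k => ⟨k.1, k.2⟩) id with hemb
  have hinj : Function.Injective emb := by
    refine Function.Injective.sumMap ?_ Function.injective_id
    rintro ⟨⟨p, hp⟩, i⟩ ⟨⟨q, hq⟩, j⟩ h
    simp only [Sigma.mk.injEq] at h
    obtain ⟨rfl, h⟩ := h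
    rw [heq_eq_eq] at h
    rw [h]
  set X : TruncIndex s N ⊕ Fin N → Ω → ℝ := fun k => (Sum.elim g h : _ → Ω → ℝ) (emb k) with hX
  have hind : iIndepFun X P := hd.indep.precomp hinj
  set T : TruncIndex s N ⊕ Fin N → ℝ → ℝ := Sum.elim (fun _ x => x) (fun _ x => √v * x + a) with hT
  have hTm : ∀ k, Measurable (T k) := by
    rintro (k | k)
    · exact measurable_id
    · exact (measurable_id.const_mul _).add_const _
  have hlaw : ∀ k, HasLaw (X k) ((gaussianReal 0 1).map (T k)) P := by
    rintro (k | k)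
    · have : (gaussianReal 0 1).map (T (Sum.inl k)) = gaussianReal 0 1 := Measure.map_id
      rw [this]
      exact hd.hasLaw_coupling _
    · have : (gaussianReal 0 1).map (T (Sum.inr k)) = gaussianReal a v :=
        gaussianReal_map_affine a v
      rw [this]
      exact hd.hasLaw_field k
  have hXm : AEMeasurable (fun ω k => X k ω) P := aemeasurable_pi_lambda _ fun k =>
    (hlaw k).aemeasurable
  have hjoint : P.map (fun ω k => X k ω)
      = (stdGaussian (TruncIndex s N ⊕ Fin N)).map fun z k => T k (z k) := by
    have hsf : ∀ k, SigmaFinite ((gaussianReal 0 1).map (T k)) := fun k => by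
      have := Measure.isProbabilityMeasure_map (μ := gaussianReal 0 1) (hTm k).aemeasurable
      infer_instance
    rw [hind.map_fun_eq_pi_map fun k => (hlaw k).aemeasurable, stdGaussian,
      Measure.pi_map_pi fun k => (hTm k).aemeasurable]
    simp only [(hlaw _).map_eq]
  have hfield : ∀ ω, truncEnergy B s (fun k => g k ω) (fun i => x + h i ω)
      = gaussianField (fun σ => constantField x σ)
        (Sum.elim (fun k σ => truncVector B v s N (Sum.inl k) σ) (fun i σ => spin σ i))
        (fun k => X k ω) := by
    intro ω
    ext σ
    simp only [truncEnergy, gaussianField, constantField, Fintype.sum_sum_type, Fintype.sum_sigma,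
      Sum.elim_inl, Sum.elim_inr, hX, hemb, Sum.map_inl, Sum.map_inr, truncVector, id,
      pureHamiltonian]
    rw [← Finset.sum_coe_sort s fun p : ℕ+ => couplingCoeff B N p *
      ∑ i : Fin (2 * (p : ℕ)) → Fin N, g ⟨p, i⟩ ω * ∏ j, spin σ (i j)]
    simp only [add_mul, Finset.sum_add_distrib, Finset.mul_sum]
    have : ∀ (p : s) (i : Fin (2 * ((p : ℕ+) : ℕ)) → Fin N),
        couplingCoeff B N p * (g ⟨p, i⟩ ω * ∏ j, spin σ (i j))
        = g ⟨p, i⟩ ω * (couplingCoeff B N p * ∏ j, spin σ (i j)) := fun p i => by ring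
    simp only [this]
    ring
  have hfield2 : ∀ z, gaussianField (fun σ => constantField x σ)
        (Sum.elim (fun k σ => truncVector B v s N (Sum.inl k) σ) (fun i σ => spin σ i))
        (fun k => T k (z k)) = gaussianField (constantField (x + a)) (truncVector B v s N) z := by
    intro z
    ext σ
    simp only [gaussianField, constantField, Fintype.sum_sum_type, Sum.elim_inl, Sum.elim_inr, hT,
      truncVector, add_mul, Finset.sum_add_distrib]
    have : ∀ i : Fin N, √v * z (Sum.inr i) * spin σ i = z (Sum.inr i) * (√v * spin σ i) :=
      fun i => by ring
    simp only [this]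
    ring
  have hcm := (continuous_gaussianField (fun σ : Config N => constantField x σ)
    (Sum.elim (fun k σ => truncVector B v s N (Sum.inl k) σ) (fun i σ => spin σ i))).measurable
  simp only [hfield]
  refine ⟨hcm.comp_aemeasurable hXm, ?_⟩
  have hcomp := AEMeasurable.map_map_of_aemeasurable hcm.aemeasurable hXm
  rw [Function.comp_def] at hcomp
  have hTm' : Measurable fun (z : TruncIndex s N ⊕ Fin N → ℝ) k => T k (z k) :=
    measurable_pi_lambda _ fun k => (hTm k).comp (measurable_pi_apply k)
  rw [← hcomp, hjoint, Measure.map_map hcm hTm']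
  congr 1
  ext z
  simp only [Function.comp, hfield2]

theorem IsDisorder.integral_logSumExp_truncEnergy (hd : IsDisorder P a v g h) (s : Finset ℕ+)
    (x : ℝ) :
    ∫ ω, logSumExp (truncEnergy B s (fun k => g k ω) (fun i => x + h i ω)) ∂P
      = truncPressure B v s (x + a) N := by
  have h1 := (hd.hasLaw_truncEnergy (B := B) s x).integral_comp (f := logSumExp)
    continuous_logSumExp.aestronglyMeasurable
  rw [integral_map (continuous_gaussianField _ _).measurable.aemeasurable
    continuous_logSumExp.aestronglyMeasurable] at h1
  exact h1

theorem IsDisorder.lintegral_exp_truncEnergy_le (hd : IsDisorder P a v g h) (hN : N ≠ 0)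
    (s : Finset ℕ+) (x t : ℝ) :
    ∫⁻ ω, ENNReal.ofReal (Real.exp (t * (logSumExp (truncEnergy B s (fun k => g k ω)
        (fun i => x + h i ω)) - truncPressure B v s (x + a) N))) ∂P
      ≤ ENNReal.ofReal (Real.exp (t ^ 2 * (N * ((∑ p ∈ s, B p ^ 2) + v)))) := by
  have hm : Measurable fun y : Config N → ℝ => ENNReal.ofReal (Real.exp (t * (logSumExp y
      - truncPressure B v s (x + a) N))) := by
    have := (continuous_logSumExp (S := Config N)).measurable
    fun_prop
  have h1 := (hd.hasLaw_truncEnergy (B := B) s x).lintegral_comp hm.aemeasurable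
  rw [lintegral_map hm (continuous_gaussianField _ _).measurable] at h1
  rw [h1]
  exact lintegral_exp_truncPressure_le B v s (x + a) hN t

theorem IsDisorder.memLp_coupling (hd : IsDisorder P a v g h) (k : CouplingIndex N) :
    MemLp (g k) 2 P := by
  have h1 : MemLp (id : ℝ → ℝ) 2 (P.map (g k)) := by
    rw [(hd.hasLaw_coupling k).map_eq]
    exact memLp_id_gaussianReal 2
  exact h1.comp_of_map (hd.hasLaw_coupling k).aemeasurable

theorem IsDisorder.memLp_field (hd : IsDisorder P a v g h) (i : Fin N) : MemLp (h i) 2 P := by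
  have h1 : MemLp (id : ℝ → ℝ) 2 (P.map (h i)) := by
    rw [(hd.hasLaw_field i).map_eq]
    exact memLp_id_gaussianReal 2
  exact h1.comp_of_map (hd.hasLaw_field i).aemeasurable

theorem IsDisorder.memLp_pureHamiltonian (hd : IsDisorder P a v g h) (p : ℕ+) (σ : Config N) :
    MemLp (fun ω => pureHamiltonian B (fun k => g k ω) p σ) 2 P := by
  unfold pureHamiltonian
  exact (memLp_finsetSum _ fun i _ => (hd.memLp_coupling _).mul_const _).const_mul _

variable [IsProbabilityMeasure P]

theorem IsDisorder.integral_sq_pureHamiltonian (hd : IsDisorder P a v g h) (hN : N ≠ 0) (p : ℕ+)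
    (σ : Config N) :
    ∫ ω, pureHamiltonian B (fun k => g k ω) p σ ^ 2 ∂P = B p ^ 2 * N := by
  set X : (Fin (2 * (p : ℕ)) → Fin N) → Ω → ℝ := fun i ω => g ⟨p, i⟩ ω * ∏ j, spin σ (i j) with hX
  have hXm : ∀ i, MemLp (X i) 2 P := fun i => (hd.memLp_coupling _).mul_const _
  have hvar : Var[∑ i, X i; P] = (N : ℝ) ^ (2 * (p : ℕ)) := by
    rw [IndepFun.variance_sum (fun i _ => hXm i)]
    · have : ∀ i, Var[X i; P] = 1 := fun i => by
        simp only [hX]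
        rw [variance_mul_const, (hd.hasLaw_coupling _).variance_eq, variance_id_gaussianReal,
          ← sq_abs (∏ j, spin σ (i j)), abs_prod_spin]
        simp
      simp [this]
    · intro i _ j _ hij
      have h1 := hd.indep.indepFun (i := Sum.inl ⟨p, i⟩) (j := Sum.inl ⟨p, j⟩) (by
        simpa using hij)
      exact h1.comp (φ := fun x => x * ∏ l, spin σ (i l)) (ψ := fun x => x * ∏ l, spin σ (j l))
        (measurable_id.mul_const _) (measurable_id.mul_const _)
  have hmean : ∫ ω, (∑ i, X i) ω ∂P = 0 := by
    simp only [Finset.sum_apply]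
    rw [integral_finsetSum _ fun i _ => (hXm i).integrable (by norm_num)]
    refine Finset.sum_eq_zero fun i _ => ?_
    simp only [hX]
    rw [integral_mul_const, (hd.hasLaw_coupling _).integral_eq]
    simp
  rw [variance_of_integral_eq_zero (memLp_finsetSum' _ fun i _ => hXm i).aemeasurable hmean] at hvar
  have : ∀ ω, pureHamiltonian B (fun k => g k ω) p σ ^ 2
      = couplingCoeff B N p ^ 2 * (∑ i, X i) ω ^ 2 := fun ω => by
    simp only [pureHamiltonian, hX, Finset.sum_apply]
    ring
  simp only [this]
  rw [integral_const_mul, hvar, couplingCoeff_sq B hN]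
  have hN' : (N : ℝ) ≠ 0 := by positivity
  field_simp

theorem IsDisorder.integral_abs_pureHamiltonian_le (hd : IsDisorder P a v g h) (hN : N ≠ 0) (p : ℕ+)
    (σ : Config N) :
    ∫ ω, |pureHamiltonian B (fun k => g k ω) p σ| ∂P ≤ |B p| * √N := by
  have hm : MemLp (fun ω => |pureHamiltonian B (fun k => g k ω) p σ|) 2 P :=
    (hd.memLp_pureHamiltonian p σ).abs
  have h1 := variance_nonneg (fun ω => |pureHamiltonian B (fun k => g k ω) p σ|) P
  rw [variance_eq_sub hm] at h1
  simp only [Pi.pow_apply, sq_abs] at h1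
  rw [hd.integral_sq_pureHamiltonian hN] at h1
  have h2 : |B p| * √N = √(B p ^ 2 * N) := by
    rw [Real.sqrt_mul (sq_nonneg _), Real.sqrt_sq_eq_abs]
  rw [h2]
  exact Real.le_sqrt_of_sq_le (by linarith)

theorem IsDisorder.summable_pureHamiltonian (hd : IsDisorder P a v g h) (hN : N ≠ 0)
    (hB : Summable fun p : ℕ+ => (2 : ℝ) ^ (p : ℕ) * B p ^ 2) (σ : Config N) :
    (∀ᵐ ω ∂P, Summable fun p => |pureHamiltonian B (fun k => g k ω) p σ|) ∧
      Integrable (fun ω => ∑' p, |pureHamiltonian B (fun k => g k ω) p σ|) P := by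
  refine ae_summable_abs_and_integrable_tsum
    (fun p => (hd.memLp_pureHamiltonian p σ).integrable (by norm_num)) ?_
  refine Summable.of_nonneg_of_le (fun p => integral_nonneg fun ω => abs_nonneg _)
    (fun p => hd.integral_abs_pureHamiltonian_le hN p σ) ?_
  exact (summable_abs_of_summable_two_pow hB).mul_right _

end

theorem abs_logSumExp_config_le {N : ℕ} (y : Config N → ℝ) :
    |logSumExp y| ≤ N * Real.log 2 + ∑ σ, |y σ| := by
  have h := abs_logSumExp_sub_le (y := y) (y' := fun _ => 0) (c := ∑ σ, |y σ|) fun σ => by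
    rw [sub_zero]
    exact abs_le_sum_abs y σ
  rw [logSumExp_zero_config] at h
  have h2 := abs_sub_abs_le_abs_sub (logSumExp y) (N * Real.log 2)
  rw [abs_of_nonneg (a := (N : ℝ) * Real.log 2)
    (mul_nonneg (Nat.cast_nonneg _) (Real.log_nonneg (by norm_num)))] at h2
  linarith

section

variable {Ω : Type*} [MeasurableSpace Ω] {P : Measure Ω} {a : ℝ} {v : ℝ≥0}
  {N : ℕ} {g : CouplingIndex N → Ω → ℝ} {h : Fin N → Ω → ℝ} {B : ℕ+ → ℝ}

theorem abs_truncEnergy_le {s : Finset ℕ+} {g : CouplingIndex N → ℝ} {h : Fin N → ℝ}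
    {σ : Config N} (hs : Summable fun p => |pureHamiltonian B g p σ|) :
    |truncEnergy B s g h σ| ≤ (∑' p, |pureHamiltonian B g p σ|) + ∑ i, |h i| := by
  refine (abs_add_le _ _).trans (add_le_add ?_ ?_)
  · exact (Finset.abs_sum_le_sum_abs _ _).trans (hs.sum_le_tsum s fun p _ => abs_nonneg _)
  · refine (Finset.abs_sum_le_sum_abs _ _).trans (le_of_eq ?_)
    simp [abs_mul, abs_spin]

theorem tendsto_truncEnergy {g : CouplingIndex N → ℝ} (h : Fin N → ℝ)
    {σ : Config N} (hs : Summable fun p => |pureHamiltonian B g p σ|) :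
    Tendsto (fun s => truncEnergy B s g h σ) atTop (𝓝 (energySK B g h σ)) :=
  (hs.of_abs.hasSum).add_const _

theorem IsDisorder.aemeasurable_energySK (hd : IsDisorder P a v g h) (x : ℝ) (σ : Config N) :
    AEMeasurable (fun ω => energySK B (fun k => g k ω) (fun i => x + h i ω) σ) P := by
  refine AEMeasurable.add ?_ ?_
  · exact AEMeasurable.tsum fun p => (hd.memLp_pureHamiltonian p σ).aestronglyMeasurable.aemeasurable
  · exact Finset.aemeasurable_fun_sum _ fun i _ =>
      (((hd.memLp_field i).aestronglyMeasurable.aemeasurable).const_add x).mul_const _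

theorem IsDisorder.aemeasurable_logSumExp_energySK (hd : IsDisorder P a v g h) (x : ℝ) :
    AEMeasurable (fun ω => logSumExp (energySK B (fun k => g k ω) fun i => x + h i ω)) P :=
  continuous_logSumExp.measurable.comp_aemeasurable
    (aemeasurable_pi_lambda _ fun σ => hd.aemeasurable_energySK x σ)

variable [IsProbabilityMeasure P] (hB : Summable fun p : ℕ+ => (2 : ℝ) ^ (p : ℕ) * B p ^ 2)

include hB

theorem IsDisorder.ae_summable_pureHamiltonian (hd : IsDisorder P a v g h) (hN : N ≠ 0) :
    ∀ᵐ ω ∂P, ∀ σ, Summable fun p => |pureHamiltonian B (fun k => g k ω) p σ| :=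
  ae_all_iff.2 fun σ => (hd.summable_pureHamiltonian hN hB σ).1

theorem IsDisorder.ae_tendsto_logSumExp (hd : IsDisorder P a v g h) (hN : N ≠ 0) (x : ℝ) :
    ∀ᵐ ω ∂P, Tendsto
      (fun s => logSumExp (truncEnergy B s (fun k => g k ω) fun i => x + h i ω)) atTop
      (𝓝 (logSumExp (energySK B (fun k => g k ω) fun i => x + h i ω))) := by
  filter_upwards [hd.ae_summable_pureHamiltonian hB hN] with ω hω
  exact (continuous_logSumExp.tendsto _).comp
    (tendsto_pi_nhds.2 fun σ => tendsto_truncEnergy _ (hω σ))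

theorem IsDisorder.exists_integrable_bound (hd : IsDisorder P a v g h) (hN : N ≠ 0) (x : ℝ) :
    ∃ D : Ω → ℝ, Integrable D P ∧ ∀ᵐ ω ∂P, ∀ s,
      |logSumExp (truncEnergy B s (fun k => g k ω) fun i => x + h i ω)| ≤ D ω := by
  refine ⟨fun ω => N * Real.log 2 + ∑ σ : Config N,
    ((∑' p, |pureHamiltonian B (fun k => g k ω) p σ|) + ∑ i, |x + h i ω|), ?_, ?_⟩
  · refine (integrable_const _).add (integrable_finsetSum _ fun σ _ => ?_)
    refine (hd.summable_pureHamiltonian hN hB σ).2.add (integrable_finsetSum _ fun i _ => ?_)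
    exact ((integrable_const x).add ((hd.memLp_field i).integrable (by norm_num))).abs
  · filter_upwards [hd.ae_summable_pureHamiltonian hB hN] with ω hω s
    refine (abs_logSumExp_config_le _).trans ?_
    gcongr with σ
    exact abs_truncEnergy_le (hω σ)

theorem IsDisorder.integrable_logSumExp_energySK (hd : IsDisorder P a v g h) (hN : N ≠ 0) (x : ℝ) :
    Integrable (fun ω => logSumExp (energySK B (fun k => g k ω) fun i => x + h i ω)) P := by
  obtain ⟨D, hD, hle⟩ := hd.exists_integrable_bound hB hN x
  refine hD.mono' (hd.aemeasurable_logSumExp_energySK x).aestronglyMeasurable ?_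
  filter_upwards [hle, hd.ae_tendsto_logSumExp hB hN x] with ω h1 h2
  rw [Real.norm_eq_abs]
  exact le_of_tendsto h2.abs (Eventually.of_forall h1)

theorem IsDisorder.tendsto_truncPressure (hd : IsDisorder P a v g h) (hN : N ≠ 0) (x : ℝ) :
    Tendsto (fun s => truncPressure B v s (x + a) N) atTop
      (𝓝 (∫ ω, logSumExp (energySK B (fun k => g k ω) fun i => x + h i ω) ∂P)) := by
  obtain ⟨D, hD, hle⟩ := hd.exists_integrable_bound hB hN x
  simp only [← hd.integral_logSumExp_truncEnergy]
  refine tendsto_integral_filter_of_dominated_convergence D (Eventually.of_forall fun s => ?_)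
    (Eventually.of_forall fun s => ?_) hD (hd.ae_tendsto_logSumExp hB hN x)
  · exact (continuous_logSumExp.measurable.comp_aemeasurable
      (hd.hasLaw_truncEnergy s x).aemeasurable).aestronglyMeasurable
  · filter_upwards [hle] with ω hω using hω s

/-- Concentration of the log-partition function. -/
theorem IsDisorder.lintegral_exp_energySK_le (hd : IsDisorder P a v g h) (hN : N ≠ 0) (x t : ℝ) :
    ∫⁻ ω, ENNReal.ofReal (Real.exp (t *
      (logSumExp (energySK B (fun k => g k ω) fun i => x + h i ω)
        - ∫ ω, logSumExp (energySK B (fun k => g k ω) fun i => x + h i ω) ∂P))) ∂P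
      ≤ ENNReal.ofReal (Real.exp (t ^ 2 * (N * ((∑' p, B p ^ 2) + v)))) := by
  set F : Finset ℕ+ → Ω → ENNReal := fun s ω => ENNReal.ofReal (Real.exp (t *
    (logSumExp (truncEnergy B s (fun k => g k ω) fun i => x + h i ω)
      - truncPressure B v s (x + a) N))) with hF
  have hFm : ∀ s, AEMeasurable (F s) P := fun s => by
    have := continuous_logSumExp.measurable.comp_aemeasurable
      (hd.hasLaw_truncEnergy (B := B) s x).aemeasurable
    exact ENNReal.measurable_ofReal.comp_aemeasurable
      (Real.measurable_exp.comp_aemeasurable ((this.sub_const _).const_mul t))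
  calc ∫⁻ ω, ENNReal.ofReal (Real.exp (t *
      (logSumExp (energySK B (fun k => g k ω) fun i => x + h i ω)
        - ∫ ω, logSumExp (energySK B (fun k => g k ω) fun i => x + h i ω) ∂P))) ∂P
      = ∫⁻ ω, liminf (fun s => F s ω) atTop ∂P := by
        refine lintegral_congr_ae ?_
        filter_upwards [hd.ae_tendsto_logSumExp hB hN x] with ω hω
        refine (Tendsto.liminf_eq ?_).symm
        refine (ENNReal.continuous_ofReal.tendsto _).comp ((Real.continuous_exp.tendsto _).comp ?_)
        exact (hω.sub (hd.tendsto_truncPressure hB hN x)).const_mul t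
    _ ≤ liminf (fun s => ∫⁻ ω, F s ω ∂P) atTop := lintegral_liminf_le' hFm
    _ ≤ liminf (fun _ : Finset ℕ+ =>
          ENNReal.ofReal (Real.exp (t ^ 2 * (N * ((∑' p, B p ^ 2) + v))))) atTop := by
        refine liminf_le_liminf (Eventually.of_forall fun s => ?_)
        refine (hd.lintegral_exp_truncEnergy_le hN s x t).trans ?_
        gcongr
        exact (summable_sq_of_summable_two_pow hB).sum_le_tsum s fun p _ => sq_nonneg _
    _ = _ := liminf_const _

end

section

variable {Ω : Type*} [MeasurableSpace Ω] {P : Measure Ω} [IsProbabilityMeasure P] {a : ℝ} {v : ℝ≥0}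
  {g : ∀ N, CouplingIndex N → Ω → ℝ} {h : ∀ N, Fin N → Ω → ℝ} {B : ℕ+ → ℝ}

omit [IsProbabilityMeasure P] in
theorem freeEnergySK_eq (N : ℕ) (x : ℝ) :
    freeEnergySK P B (g N) (fun i ω => x + h N i ω)
      = (∫ ω, logSumExp (energySK B (fun k => g N k ω) fun i => x + h N i ω) ∂P) / N := by
  simp only [freeEnergySK, log_partitionFunction_zero]

/-- The thermodynamic limit of the free energy exists. -/
theorem tendsto_freeEnergySK (hgh : ∀ N, IsDisorder P a v (g N) (h N))
    (hB : Summable fun p : ℕ+ => (2 : ℝ) ^ (p : ℕ) * B p ^ 2) (x : ℝ) :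
    Tendsto (fun N => freeEnergySK P B (g N) fun i ω => x + h N i ω) atTop
      (𝓝 (limitFreeEnergySK P B g h x)) := by
  set u : ℕ → ℝ := fun N => -∫ ω, logSumExp (energySK B (fun k => g N k ω) fun i => x + h N i ω) ∂P
    with hu
  have hu0 : u 0 = 0 := by
    have : ∀ ω, logSumExp (energySK B (fun k => g 0 k ω) fun i => x + h 0 i ω) = 0 := fun ω => by
      simp [logSumExp, energySK, hamiltonianSK]
    simp [hu, this]
  have hsub : Subadditive u := by
    intro m n
    rcases eq_or_ne m 0 with rfl | hm
    · simp [hu0]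
    rcases eq_or_ne n 0 with rfl | hn
    · simp [hu0]
    have := le_of_tendsto_of_tendsto'
      (((hgh m).tendsto_truncPressure hB hm x).add ((hgh n).tendsto_truncPressure hB hn x))
      ((hgh (m + n)).tendsto_truncPressure hB (by omega) x)
      fun s => truncPressure_add_le B v s (x + a) hm hn
    simp only [hu]
    linarith
  have hbdd : BddBelow (range fun n => u n / n) := by
    refine ⟨-(Real.log 2 + |x + a| + ((∑' p, B p ^ 2) + v) / 2), ?_⟩
    rintro _ ⟨n, rfl⟩
    rcases eq_or_ne n 0 with rfl | hn
    · simp only [CharP.cast_eq_zero, div_zero, Left.neg_nonpos_iff]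
      have h1 : 0 ≤ ∑' p, B p ^ 2 := tsum_nonneg fun p => sq_nonneg _
      have h2 : 0 ≤ Real.log 2 := Real.log_nonneg (by norm_num)
      positivity
    · have hn' : (0 : ℝ) < n := by positivity
      have h1 : ∫ ω, logSumExp (energySK B (fun k => g n k ω) fun i => x + h n i ω) ∂P
          ≤ n * (Real.log 2 + |x + a| + ((∑' p, B p ^ 2) + v) / 2) := by
        refine le_of_tendsto' ((hgh n).tendsto_truncPressure hB hn x) fun s => ?_
        refine (truncPressure_le B v s (x + a) hn).trans ?_
        gcongr
        exact (summable_sq_of_summable_two_pow hB).sum_le_tsum s fun p _ => sq_nonneg _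
      simp only
      rw [le_div_iff₀ hn']
      simp only [hu]
      linarith
  have hlim := (hsub.tendsto_lim hbdd).neg
  have : (fun n => -(u n / n)) = fun N => freeEnergySK P B (g N) fun i ω => x + h N i ω := by
    ext N
    rw [freeEnergySK_eq]
    simp only [hu]
    ring
  rw [this] at hlim
  have h2 := hlim.limUnder_eq
  rw [limitFreeEnergySK, h2]
  exact hlim

theorem abs_logSumExp_energySK_sub_le {N : ℕ} (g : CouplingIndex N → ℝ) (h : Fin N → ℝ)
    (x y : ℝ) :
    |logSumExp (energySK B g fun i => x + h i) - logSumExp (energySK B g fun i => y + h i)|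
      ≤ N * |x - y| := by
  refine abs_logSumExp_sub_le fun σ => ?_
  have : energySK B g (fun i => x + h i) σ - energySK B g (fun i => y + h i) σ
      = constantField (x - y) σ := by
    simp only [energySK, constantField, add_mul, sub_mul, Finset.sum_add_distrib,
      Finset.sum_sub_distrib]
    ring
  rw [this]
  exact abs_constantField_le _ _

theorem abs_freeEnergySK_sub_le (hgh : ∀ N, IsDisorder P a v (g N) (h N))
    (hB : Summable fun p : ℕ+ => (2 : ℝ) ^ (p : ℕ) * B p ^ 2) {N : ℕ} (hN : N ≠ 0) (x y : ℝ) :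
    |freeEnergySK P B (g N) (fun i ω => x + h N i ω)
      - freeEnergySK P B (g N) (fun i ω => y + h N i ω)| ≤ |x - y| := by
  have hN' : (0 : ℝ) < N := by positivity
  rw [freeEnergySK_eq, freeEnergySK_eq, ← sub_div, abs_div, abs_of_pos hN', div_le_iff₀ hN',
    ← integral_sub ((hgh N).integrable_logSumExp_energySK hB hN x)
      ((hgh N).integrable_logSumExp_energySK hB hN y)]
  have h1 := norm_integral_le_of_norm_le_const (μ := P) (C := N * |x - y|)
    (f := fun ω => logSumExp (energySK B (fun k => g N k ω) fun i => x + h N i ω)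
      - logSumExp (energySK B (fun k => g N k ω) fun i => y + h N i ω))
    (ae_of_all _ fun ω => abs_logSumExp_energySK_sub_le _ _ x y)
  rw [Real.norm_eq_abs] at h1
  simp only [probReal_univ, mul_one] at h1
  linarith

theorem abs_limitFreeEnergySK_sub_le (hgh : ∀ N, IsDisorder P a v (g N) (h N))
    (hB : Summable fun p : ℕ+ => (2 : ℝ) ^ (p : ℕ) * B p ^ 2) (x y : ℝ) :
    |limitFreeEnergySK P B g h x - limitFreeEnergySK P B g h y| ≤ |x - y| := by
  refine le_of_tendsto ((tendsto_freeEnergySK hgh hB x).sub (tendsto_freeEnergySK hgh hB y)).abs ?_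
  filter_upwards [eventually_ne_atTop 0] with N hN
  exact abs_freeEnergySK_sub_le hgh hB hN x y

end

/-- Equi-Lipschitz functions that converge pointwise converge uniformly on compact intervals. -/
theorem eventually_abs_sub_le_of_lipschitz {φ : ℕ → ℝ → ℝ} {f : ℝ → ℝ}
    (hφ : ∀ᶠ n in atTop, ∀ x y, |φ n x - φ n y| ≤ |x - y|) (hf : ∀ x y, |f x - f y| ≤ |x - y|)
    (hlim : ∀ x, Tendsto (fun n => φ n x) atTop (𝓝 (f x))) (a b : ℝ) {ε : ℝ} (hε : 0 < ε) :
    ∀ᶠ n in atTop, ∀ x ∈ Icc a b, |φ n x - f x| ≤ ε := by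
  obtain ⟨t, -, htf, ht⟩ := (isCompact_Icc (a := a) (b := b)).finite_cover_balls
    (show 0 < ε / 3 by positivity)
  have hev : ∀ᶠ n in atTop, ∀ y ∈ t, |φ n y - f y| < ε / 3 :=
    (eventually_all_finite htf).2 fun y _ => by
      have := (Metric.tendsto_nhds.1 (hlim y)) (ε / 3) (by positivity)
      simpa [Real.dist_eq] using this
  filter_upwards [hφ, hev] with n h1 h2 x hx
  obtain ⟨y, hy, hxy⟩ := mem_iUnion₂.1 (ht hx)
  rw [Metric.mem_ball, Real.dist_eq] at hxy
  have h3 := h1 x y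
  have h4 := hf y x
  rw [abs_sub_comm y x] at h4
  have h5 : φ n x - f x = (φ n x - φ n y) + (φ n y - f y) + (f y - f x) := by ring
  rw [h5]
  have h6 := abs_add_three (φ n x - φ n y) (φ n y - f y) (f y - f x)
  linarith [h2 y hy]

/-- A continuous function on `[-1, 1]` stays away from its maximum on sets that stay away from its
maximizers. -/
theorem exists_gap {f : ℝ → ℝ} (hf : Continuous f) {U : Set ℝ} (hU : U ⊆ Icc (-1) 1) {δ : ℝ}
    (hδ : 0 < δ) (hsep : ∀ x ∈ U, ∀ y ∈ Icc (-1 : ℝ) 1, IsMaxOn f (Icc (-1) 1) y → δ ≤ |x - y|) :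
    ∃ ν ∈ Icc (-1 : ℝ) 1, ∃ ε > 0, ∀ μ ∈ U, f μ ≤ f ν - ε := by
  obtain ⟨ν, hν, hmax⟩ := isCompact_Icc.exists_isMaxOn (nonempty_Icc.2 (by norm_num : (-1 : ℝ) ≤ 1))
    hf.continuousOn
  rcases U.eq_empty_or_nonempty with rfl | hne
  · exact ⟨ν, hν, 1, one_pos, by simp⟩
  have hcl : closure U ⊆ Icc (-1) 1 := closure_minimal hU isClosed_Icc
  obtain ⟨z, hz, hzmax⟩ := (isCompact_Icc.of_isClosed_subset isClosed_closure hcl).exists_isMaxOn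
    hne.closure hf.continuousOn
  have hlt : f z < f ν := by
    by_contra hcon
    have hzm : IsMaxOn f (Icc (-1) 1) z := fun y hy => (hmax hy).trans (not_lt.1 hcon)
    obtain ⟨x, hx, hxz⟩ := Metric.mem_closure_iff.1 hz δ hδ
    have := hsep x hx z (hcl hz) hzm
    rw [dist_comm, Real.dist_eq] at hxz
    linarith
  refine ⟨ν, hν, f ν - f z, by linarith, fun μ hμ => ?_⟩
  have : f μ ≤ f z := hzmax (subset_closure hμ)
  linarith

section

variable {N : ℕ} (β : ℝ) (B : ℕ+ → ℝ) (g : CouplingIndex N → ℝ) (h : Fin N → ℝ)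

theorem partitionFunction_pos : 0 < partitionFunction β B g h := sum_exp_pos _

theorem gibbsWeight_nonneg (σ : Config N) : 0 ≤ gibbsWeight β B g h σ :=
  div_nonneg (Real.exp_pos _).le (partitionFunction_pos β B g h).le

theorem gibbsMagnetization_nonneg (U : Set ℝ) : 0 ≤ gibbsMagnetization β B g h U :=
  Finset.sum_nonneg fun σ _ => mul_nonneg (indicator_nonneg (fun _ _ => zero_le_one) _)
    (gibbsWeight_nonneg β B g h σ)

theorem gibbsMagnetization_le_one (U : Set ℝ) : gibbsMagnetization β B g h U ≤ 1 := by
  have h1 : ∑ σ, gibbsWeight β B g h σ = 1 := by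
    simp only [gibbsWeight]
    rw [← Finset.sum_div]
    exact div_self (partitionFunction_pos β B g h).ne'
  rw [← h1]
  refine Finset.sum_le_sum fun σ _ => ?_
  exact mul_le_of_le_one_left (gibbsWeight_nonneg β B g h σ)
    (indicator_le_self' (fun _ _ => zero_le_one) _)

/-- The possible values of the magnetization. -/
noncomputable def magnetizationValues (N : ℕ) : Finset ℝ :=
  (Finset.range (N + 1)).image fun k : ℕ => (2 * (k : ℝ) - N) / N

theorem card_magnetizationValues_le (N : ℕ) : (magnetizationValues N).card ≤ N + 1 :=
  Finset.card_image_le.trans (by simp)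

theorem magnetization_mem_values (σ : Config N) : magnetization σ ∈ magnetizationValues N := by
  refine Finset.mem_image.2 ⟨(Finset.univ.filter fun i => σ i = 1).card, ?_, ?_⟩
  · rw [Finset.mem_range, Nat.lt_succ_iff]
    exact (Finset.card_le_univ _).trans (by simp)
  · unfold magnetization
    congr 1
    have : ∀ i, spin σ i = 2 * (if σ i = 1 then 1 else 0) - 1 := fun i => by
      rcases Int.units_eq_one_or (σ i) with h | h
      · simp [spin, h]
        norm_num
      · simp [spin, h]
    simp only [this, Finset.sum_sub_distrib, ← Finset.mul_sum, Finset.sum_boole]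
    simp

open Classical in
theorem gibbsMagnetization_le_sum (U : Set ℝ) :
    gibbsMagnetization β B g h U
      ≤ ∑ μ ∈ (magnetizationValues N).filter (· ∈ U), gibbsMagnetization β B g h {μ} := by
  simp only [gibbsMagnetization, gibbsAverage]
  rw [Finset.sum_comm]
  refine Finset.sum_le_sum fun σ _ => ?_
  rw [← Finset.sum_mul]
  refine mul_le_mul_of_nonneg_right ?_ (gibbsWeight_nonneg β B g h σ)
  by_cases hσ : magnetization σ ∈ U
  · rw [indicator_of_mem hσ]
    have hmem : magnetization σ ∈ (magnetizationValues N).filter (· ∈ U) :=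
      Finset.mem_filter.2 ⟨magnetization_mem_values σ, hσ⟩
    refine le_trans ?_ (Finset.single_le_sum (f := fun μ : ℝ =>
      ({μ} : Set ℝ).indicator (fun _ => (1 : ℝ)) (magnetization σ))
      (fun μ _ => indicator_nonneg (fun _ _ => zero_le_one) _) hmem)
    simp
  · rw [indicator_of_notMem hσ]
    exact Finset.sum_nonneg fun μ _ => indicator_nonneg (fun _ _ => zero_le_one) _

variable {β}

theorem energySK_shift_eq (hN : N ≠ 0) (μ : ℝ) (σ : Config N) :
    energySK B g (fun i => β * μ + h i) σ - N * (β * μ ^ 2 / 2)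
      = hamiltonian β B g h σ - β * N / 2 * (magnetization σ - μ) ^ 2 := by
  have hm : ∑ i, spin σ i = N * magnetization σ := by
    unfold magnetization
    field_simp
  simp only [energySK, hamiltonian, add_mul, Finset.sum_add_distrib]
  rw [← Finset.mul_sum, hm]
  ring

theorem gibbsMagnetization_singleton_le_exp (hβ : 0 ≤ β) (hN : N ≠ 0) (μ ν : ℝ) :
    gibbsMagnetization β B g h {μ} ≤ Real.exp
      ((logSumExp (energySK B g fun i => β * μ + h i) - N * (β * μ ^ 2 / 2))
        - (logSumExp (energySK B g fun i => β * ν + h i) - N * (β * ν ^ 2 / 2))) := by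
  have hlow : Real.exp (logSumExp (energySK B g fun i => β * ν + h i) - N * (β * ν ^ 2 / 2))
      ≤ partitionFunction β B g h := by
    rw [Real.exp_sub, exp_logSumExp, Finset.sum_div]
    refine Finset.sum_le_sum fun σ _ => ?_
    rw [← Real.exp_sub, Real.exp_le_exp, energySK_shift_eq B g h hN]
    have : 0 ≤ β * N / 2 * (magnetization σ - ν) ^ 2 := by positivity
    linarith
  have hup : gibbsMagnetization β B g h {μ} * partitionFunction β B g h
      ≤ Real.exp (logSumExp (energySK B g fun i => β * μ + h i) - N * (β * μ ^ 2 / 2)) := by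
    rw [Real.exp_sub, exp_logSumExp, Finset.sum_div, gibbsMagnetization, gibbsAverage,
      Finset.sum_mul]
    refine Finset.sum_le_sum fun σ _ => ?_
    rw [← Real.exp_sub, energySK_shift_eq B g h hN, gibbsWeight, mul_assoc,
      div_mul_cancel₀ _ (partitionFunction_pos β B g h).ne']
    by_cases hσ : magnetization σ = μ
    · rw [indicator_of_mem (by simpa using hσ), hσ]
      simp
    · rw [indicator_of_notMem (by simpa using hσ), zero_mul]
      exact (Real.exp_pos _).le
  rw [Real.exp_sub, le_div_iff₀ (Real.exp_pos _)]
  exact (mul_le_mul_of_nonneg_left hlow (gibbsMagnetization_nonneg β B g h _)).trans hup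

theorem gibbsMagnetization_singleton_le (hβ : 0 ≤ β) (hN : N ≠ 0) (μ ν : ℝ) {r : ℝ} (hr : 0 ≤ r)
    (hr1 : r ≤ 1) :
    gibbsMagnetization β B g h {μ} ≤ Real.exp
      (r * ((logSumExp (energySK B g fun i => β * μ + h i) - N * (β * μ ^ 2 / 2))
        - (logSumExp (energySK B g fun i => β * ν + h i) - N * (β * ν ^ 2 / 2)))) := by
  have h1 := gibbsMagnetization_singleton_le_exp B g h hβ hN μ ν
  set y := (logSumExp (energySK B g fun i => β * μ + h i) - N * (β * μ ^ 2 / 2))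
        - (logSumExp (energySK B g fun i => β * ν + h i) - N * (β * ν ^ 2 / 2))
  rcases le_total 0 y with hy | hy
  · exact (gibbsMagnetization_le_one β B g h _).trans (Real.one_le_exp (mul_nonneg hr hy))
  · refine h1.trans (Real.exp_le_exp.2 ?_)
    nlinarith

end

section

variable {Ω : Type*} [MeasurableSpace Ω] {P : Measure Ω} {a : ℝ} {v : ℝ≥0}
  {N : ℕ} {g : CouplingIndex N → Ω → ℝ} {h : Fin N → Ω → ℝ} {B : ℕ+ → ℝ}

theorem IsDisorder.aemeasurable_gibbsMagnetization (hd : IsDisorder P a v g h) (β : ℝ)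
    (U : Set ℝ) :
    AEMeasurable (fun ω => gibbsMagnetization β B (fun k => g k ω) (fun i => h i ω) U) P := by
  have hH : ∀ σ : Config N,
      AEMeasurable (fun ω => hamiltonian β B (fun k => g k ω) (fun i => h i ω) σ) P := fun σ => by
    have := (hd.aemeasurable_energySK (B := B) 0 σ).const_add (β * N / 2 * magnetization σ ^ 2)
    simpa only [hamiltonian, energySK, zero_add, add_assoc] using this
  have hE : ∀ σ : Config N, AEMeasurable (fun ω => Real.exp
      (hamiltonian β B (fun k => g k ω) (fun i => h i ω) σ)) P := fun σ =>
    Real.measurable_exp.comp_aemeasurable (hH σ)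
  unfold gibbsMagnetization gibbsAverage gibbsWeight partitionFunction
  exact Finset.aemeasurable_fun_sum _ fun σ _ =>
    ((hE σ).div (Finset.aemeasurable_fun_sum _ fun τ _ => hE τ)).const_mul _

variable [IsProbabilityMeasure P]

theorem IsDisorder.integrable_gibbsMagnetization (hd : IsDisorder P a v g h) (β : ℝ) (U : Set ℝ) :
    Integrable (fun ω => gibbsMagnetization β B (fun k => g k ω) (fun i => h i ω) U) P :=
  Integrable.of_bound (hd.aemeasurable_gibbsMagnetization β U).aestronglyMeasurable 1
    (ae_of_all _ fun ω => by
      rw [Real.norm_of_nonneg (gibbsMagnetization_nonneg _ _ _ _ _)]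
      exact gibbsMagnetization_le_one _ _ _ _ _)

/-- Exponential moments of differences of centered log-partition functions. -/
theorem IsDisorder.lintegral_exp_sub_le (hd : IsDisorder P a v g h)
    (hB : Summable fun p : ℕ+ => (2 : ℝ) ^ (p : ℕ) * B p ^ 2) (hN : N ≠ 0) (x y r : ℝ) :
    ∫⁻ ω, ENNReal.ofReal (Real.exp (r *
      ((logSumExp (energySK B (fun k => g k ω) fun i => x + h i ω)
        - ∫ ω, logSumExp (energySK B (fun k => g k ω) fun i => x + h i ω) ∂P)
      - (logSumExp (energySK B (fun k => g k ω) fun i => y + h i ω)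
        - ∫ ω, logSumExp (energySK B (fun k => g k ω) fun i => y + h i ω) ∂P)))) ∂P
      ≤ ENNReal.ofReal (Real.exp (4 * r ^ 2 * (N * ((∑' p, B p ^ 2) + v)))) := by
  set X : ℝ → Ω → ℝ := fun x ω => logSumExp (energySK B (fun k => g k ω) fun i => x + h i ω)
    - ∫ ω, logSumExp (energySK B (fun k => g k ω) fun i => x + h i ω) ∂P with hX
  set E := Real.exp (4 * r ^ 2 * (N * ((∑' p, B p ^ 2) + v))) with hE
  have hXm : ∀ x, AEMeasurable (X x) P := fun x =>
    (hd.aemeasurable_logSumExp_energySK x).sub_const _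
  have hmom : ∀ x t, t ^ 2 = 4 * r ^ 2 →
      ∫⁻ ω, ENNReal.ofReal (1 / 2 * Real.exp (t * X x ω)) ∂P ≤ ENNReal.ofReal (1 / 2 * E) := by
    intro x t ht
    have h1 := hd.lintegral_exp_energySK_le hB hN x t
    rw [ht] at h1
    simp only [ENNReal.ofReal_mul (show (0 : ℝ) ≤ 1 / 2 by norm_num)]
    rw [lintegral_const_mul' _ _ ENNReal.ofReal_ne_top]
    gcongr
  have hpt : ∀ ω, Real.exp (r * (X x ω - X y ω))
      ≤ 1 / 2 * Real.exp (2 * r * X x ω) + 1 / 2 * Real.exp (-(2 * r) * X y ω) := fun ω => by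
    have e1 : Real.exp (2 * r * X x ω) = Real.exp (r * X x ω) ^ 2 := by
      rw [← Real.exp_nat_mul]
      congr 1
      push_cast
      ring
    have e2 : Real.exp (-(2 * r) * X y ω) = Real.exp (-(r * X y ω)) ^ 2 := by
      rw [← Real.exp_nat_mul]
      congr 1
      push_cast
      ring
    have e3 : Real.exp (r * (X x ω - X y ω)) = Real.exp (r * X x ω) * Real.exp (-(r * X y ω)) := by
      rw [← Real.exp_add]
      congr 1
      ring
    rw [e1, e2, e3]
    nlinarith [sq_nonneg (Real.exp (r * X x ω) - Real.exp (-(r * X y ω)))]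
  calc ∫⁻ ω, ENNReal.ofReal (Real.exp (r * (X x ω - X y ω))) ∂P
      ≤ ∫⁻ ω, (ENNReal.ofReal (1 / 2 * Real.exp (2 * r * X x ω))
          + ENNReal.ofReal (1 / 2 * Real.exp (-(2 * r) * X y ω))) ∂P := by
        refine lintegral_mono fun ω => ?_
        rw [← ENNReal.ofReal_add (by positivity) (by positivity)]
        exact ENNReal.ofReal_le_ofReal (hpt ω)
    _ = (∫⁻ ω, ENNReal.ofReal (1 / 2 * Real.exp (2 * r * X x ω)) ∂P)
          + ∫⁻ ω, ENNReal.ofReal (1 / 2 * Real.exp (-(2 * r) * X y ω)) ∂P := by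
        refine lintegral_add_left' ?_ _
        exact ENNReal.measurable_ofReal.comp_aemeasurable
          ((Real.measurable_exp.comp_aemeasurable ((hXm x).const_mul _)).const_mul _)
    _ ≤ ENNReal.ofReal (1 / 2 * E) + ENNReal.ofReal (1 / 2 * E) :=
        add_le_add (hmom x _ (by ring)) (hmom y _ (by ring))
    _ = ENNReal.ofReal E := by
        rw [← ENNReal.ofReal_add (by positivity) (by positivity)]
        congr 1
        ring

theorem IsDisorder.integral_gibbsMagnetization_singleton_le (hd : IsDisorder P a v g h)
    (hB : Summable fun p : ℕ+ => (2 : ℝ) ^ (p : ℕ) * B p ^ 2) (hN : N ≠ 0) {β : ℝ} (hβ : 0 ≤ β)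
    (μ ν : ℝ) {r : ℝ} (hr : 0 ≤ r) (hr1 : r ≤ 1) :
    ∫ ω, gibbsMagnetization β B (fun k => g k ω) (fun i => h i ω) {μ} ∂P
      ≤ Real.exp (N * (r *
        ((freeEnergySK P B g (fun i ω => β * μ + h i ω) - β * μ ^ 2 / 2)
          - (freeEnergySK P B g (fun i ω => β * ν + h i ω) - β * ν ^ 2 / 2))
        + 4 * r ^ 2 * ((∑' p, B p ^ 2) + v))) := by
  set L : ℝ → Ω → ℝ := fun x ω => logSumExp (energySK B (fun k => g k ω) fun i => x + h i ω)
  have hF : ∀ x, freeEnergySK P B g (fun i ω => x + h i ω) = (∫ ω, L x ω ∂P) / N := fun x => by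
    simp only [freeEnergySK, log_partitionFunction_zero, L]
  set A : ℝ := N * (r * ((freeEnergySK P B g (fun i ω => β * μ + h i ω) - β * μ ^ 2 / 2)
          - (freeEnergySK P B g (fun i ω => β * ν + h i ω) - β * ν ^ 2 / 2))) with hA
  have hN' : (N : ℝ) ≠ 0 := by positivity
  rw [integral_eq_lintegral_of_nonneg_ae
    (ae_of_all _ fun ω => gibbsMagnetization_nonneg _ _ _ _ _)
    (hd.aemeasurable_gibbsMagnetization β _).aestronglyMeasurable]
  refine ENNReal.toReal_le_of_le_ofReal (Real.exp_pos _).le ?_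
  calc ∫⁻ ω, ENNReal.ofReal (gibbsMagnetization β B (fun k => g k ω) (fun i => h i ω) {μ}) ∂P
      ≤ ∫⁻ ω, ENNReal.ofReal (Real.exp A) * ENNReal.ofReal (Real.exp (r *
          ((L (β * μ) ω - ∫ ω, L (β * μ) ω ∂P) - (L (β * ν) ω - ∫ ω, L (β * ν) ω ∂P)))) ∂P := by
        refine lintegral_mono fun ω => ?_
        rw [← ENNReal.ofReal_mul (Real.exp_pos _).le, ← Real.exp_add]
        refine ENNReal.ofReal_le_ofReal ((gibbsMagnetization_singleton_le B _ _ hβ hN μ ν hr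
          hr1).trans (Real.exp_le_exp.2 (le_of_eq ?_)))
        rw [hA, hF, hF]
        simp only [L]
        field_simp
        ring
    _ ≤ ENNReal.ofReal (Real.exp A)
          * ENNReal.ofReal (Real.exp (4 * r ^ 2 * (N * ((∑' p, B p ^ 2) + v)))) := by
        rw [lintegral_const_mul' _ _ ENNReal.ofReal_ne_top]
        gcongr
        exact hd.lintegral_exp_sub_le hB hN _ _ r
    _ = _ := by
        rw [← ENNReal.ofReal_mul (Real.exp_pos _).le, ← Real.exp_add, hA]
        congr 2
        ring

end

theorem exists_exp_bound_of_eventually {u : ℕ → ℝ} (hu : ∀ n, u n ≤ 1) {κ : ℝ} (hκ : 0 < κ)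
    (h : ∀ᶠ n : ℕ in atTop, u n ≤ (n + 1) * Real.exp (-(κ * n))) :
    ∃ K : ℝ, 0 < K ∧ ∀ n : ℕ, u n ≤ K * Real.exp (-(n : ℝ) / K) := by
  obtain ⟨n₀, hn₀⟩ := eventually_atTop.1 h
  set K : ℝ := 2 / κ + 1 + Real.exp (κ / 2 * n₀) with hK
  have hKpos : 0 < K := by positivity
  have hKinv : 1 / K ≤ κ / 2 := by
    rw [div_le_iff₀ hKpos]
    have h1 : κ / 2 * (2 / κ) = 1 := by field_simp
    have h2 : 2 / κ ≤ K := by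
      rw [hK]
      linarith [Real.exp_pos (κ / 2 * n₀)]
    calc (1 : ℝ) = κ / 2 * (2 / κ) := h1.symm
      _ ≤ κ / 2 * K := by gcongr
  have hexp : ∀ n : ℕ, Real.exp (-(κ / 2 * n)) ≤ Real.exp (-(n : ℝ) / K) := fun n => by
    rw [Real.exp_le_exp, neg_div, neg_le_neg_iff]
    calc (n : ℝ) / K = 1 / K * n := by ring
      _ ≤ κ / 2 * n := by gcongr
  refine ⟨K, hKpos, fun n => ?_⟩
  have hfinal : ∀ C : ℝ, 0 ≤ C → C ≤ K → u n ≤ C * Real.exp (-(κ / 2 * n)) →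
      u n ≤ K * Real.exp (-(n : ℝ) / K) := fun C hC hCK h =>
    h.trans (mul_le_mul hCK (hexp n) (Real.exp_pos _).le hKpos.le)
  rcases le_total n₀ n with hn | hn
  · refine hfinal (2 / κ + 1) (by positivity) (by rw [hK]; linarith [Real.exp_pos (κ / 2 * n₀)]) ?_
    refine (hn₀ n hn).trans ?_
    have e : Real.exp (-(κ * n)) = Real.exp (-(κ / 2 * n)) * Real.exp (-(κ / 2 * n)) := by
      rw [← Real.exp_add]
      congr 1
      ring
    rw [e, ← mul_assoc]
    refine mul_le_mul_of_nonneg_right ?_ (Real.exp_pos _).le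
    rw [Real.exp_neg, ← div_eq_mul_inv, div_le_iff₀ (Real.exp_pos _)]
    have h1 := Real.add_one_le_exp (κ / 2 * n)
    have h2 : (n : ℝ) = 2 / κ * (κ / 2 * n) := by field_simp
    have h3 : 2 / κ * (κ / 2 * n) ≤ 2 / κ * Real.exp (κ / 2 * n) := by
      gcongr
      linarith
    have h4 : (1 : ℝ) ≤ Real.exp (κ / 2 * n) := Real.one_le_exp (by positivity)
    rw [add_mul]
    linarith
  · refine hfinal (Real.exp (κ / 2 * n₀)) (Real.exp_pos _).le (by
      rw [hK]
      have : 0 < 2 / κ := by positivity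
      linarith) ?_
    rw [← Real.exp_add]
    refine (hu n).trans (Real.one_le_exp ?_)
    have h1 : (n : ℝ) ≤ n₀ := by exact_mod_cast hn
    nlinarith

section

variable {Ω : Type*} [MeasurableSpace Ω] {P : Measure Ω} [IsProbabilityMeasure P] {a : ℝ} {v : ℝ≥0}
  {g : ∀ N, CouplingIndex N → Ω → ℝ} {h : ∀ N, Fin N → Ω → ℝ} {B : ℕ+ → ℝ}

/-- Exponential concentration of the magnetization around the set of maximizers. -/
theorem exists_integral_gibbsMagnetization_le (hgh : ∀ N, IsDisorder P a v (g N) (h N))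
    (hB : Summable fun p : ℕ+ => (2 : ℝ) ^ (p : ℕ) * B p ^ 2) {β : ℝ} (hβ : 0 ≤ β) {U : Set ℝ}
    (hU : U ⊆ Icc (-1) 1) {δ : ℝ} (hδ : 0 < δ)
    (hsep : ∀ x ∈ U, ∀ y ∈ argmaxSet P β B g h, δ ≤ |x - y|) :
    ∃ K : ℝ, 0 < K ∧ ∀ N : ℕ,
      ∫ ω, gibbsMagnetization β B (fun k => g N k ω) (fun i => h N i ω) U ∂P
        ≤ K * Real.exp (-(N : ℝ) / K) := by
  classical
  have hFc : Continuous (limitFreeEnergySK P B g h) :=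
    continuous_of_abs_sub_le (a := 1) fun x y => by
      rw [one_mul]
      exact abs_limitFreeEnergySK_sub_le hgh hB x y
  obtain ⟨ν, hν, ε, hε, hgap⟩ := exists_gap
    (f := fun μ => limitFreeEnergySK P B g h (β * μ) - β * μ ^ 2 / 2) (by fun_prop) hU hδ
    fun x hx y hy hmax => hsep x hx y ⟨hy, hmax⟩
  set D : ℝ := (∑' p, B p ^ 2) + v with hD
  have hD0 : 0 ≤ D := add_nonneg (tsum_nonneg fun p => sq_nonneg _) v.coe_nonneg
  set r : ℝ := min 1 (ε / (16 * (D + 1))) with hr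
  have hr0 : 0 < r := lt_min one_pos (by positivity)
  have hrD : 16 * (r * D) ≤ ε := by
    have h1 : r * (16 * (D + 1)) ≤ ε := by
      rw [← le_div_iff₀ (by positivity)]
      exact min_le_right _ _
    nlinarith
  have hunif := eventually_abs_sub_le_of_lipschitz
    (φ := fun N x => freeEnergySK P B (g N) fun i ω => x + h N i ω)
    (by
      filter_upwards [eventually_ne_atTop 0] with N hN
      exact abs_freeEnergySK_sub_le hgh hB hN)
    (abs_limitFreeEnergySK_sub_le hgh hB) (tendsto_freeEnergySK hgh hB) (-β) β
    (show 0 < ε / 4 by positivity)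
  have hmem : ∀ μ ∈ Icc (-1 : ℝ) 1, β * μ ∈ Icc (-β) β := fun μ hμ =>
    ⟨by nlinarith [hμ.1], by nlinarith [hμ.2]⟩
  refine exists_exp_bound_of_eventually (κ := r * ε / 4) (fun N => ?_) (by positivity) ?_
  · refine (integral_mono ((hgh N).integrable_gibbsMagnetization β U) (integrable_const 1)
      fun ω => gibbsMagnetization_le_one _ _ _ _ _).trans ?_
    simp
  filter_upwards [hunif, eventually_ne_atTop 0] with N hunifN hN
  have hterm : ∀ μ ∈ (magnetizationValues N).filter (· ∈ U),
      ∫ ω, gibbsMagnetization β B (fun k => g N k ω) (fun i => h N i ω) {μ} ∂P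
        ≤ Real.exp (-(r * ε / 4 * N)) := fun μ hμ => by
    have hμU := (Finset.mem_filter.1 hμ).2
    refine ((hgh N).integral_gibbsMagnetization_singleton_le hB hN hβ μ ν hr0.le
      (min_le_left _ _)).trans (Real.exp_le_exp.2 ?_)
    have h1 := (abs_le.1 (hunifN _ (hmem μ (hU hμU)))).2
    have h2 := (abs_le.1 (hunifN _ (hmem ν hν))).1
    have h3 := hgap μ hμU
    have h4 : (freeEnergySK P B (g N) (fun i ω => β * μ + h N i ω) - β * μ ^ 2 / 2)
          - (freeEnergySK P B (g N) (fun i ω => β * ν + h N i ω) - β * ν ^ 2 / 2) ≤ -(ε / 2) := by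
      linarith
    have h5 := mul_le_mul_of_nonneg_left h4 hr0.le
    have h6 : 4 * r ^ 2 * D ≤ r * ε / 4 := by nlinarith
    have h7 : -(r * ε / 4 * N) = N * (-(r * ε / 4)) := by ring
    rw [h7]
    refine mul_le_mul_of_nonneg_left ?_ (Nat.cast_nonneg N)
    linarith
  calc ∫ ω, gibbsMagnetization β B (fun k => g N k ω) (fun i => h N i ω) U ∂P
      ≤ ∫ ω, ∑ μ ∈ (magnetizationValues N).filter (· ∈ U),
          gibbsMagnetization β B (fun k => g N k ω) (fun i => h N i ω) {μ} ∂P :=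
        integral_mono ((hgh N).integrable_gibbsMagnetization β U)
          (integrable_finsetSum _ fun μ _ => (hgh N).integrable_gibbsMagnetization β {μ})
          fun ω => gibbsMagnetization_le_sum _ _ _ _ U
    _ = ∑ μ ∈ (magnetizationValues N).filter (· ∈ U),
          ∫ ω, gibbsMagnetization β B (fun k => g N k ω) (fun i => h N i ω) {μ} ∂P :=
        integral_finsetSum _ fun μ _ => (hgh N).integrable_gibbsMagnetization β {μ}
    _ ≤ ((magnetizationValues N).filter (· ∈ U)).card * Real.exp (-(r * ε / 4 * N)) := by
        rw [← nsmul_eq_mul]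
        exact Finset.sum_le_card_nsmul _ _ _ hterm
    _ ≤ (N + 1) * Real.exp (-(r * ε / 4 * N)) := by
        refine mul_le_mul_of_nonneg_right ?_ (Real.exp_pos _).le
        exact_mod_cast (Finset.card_filter_le _ _).trans (card_magnetizationValues_le N)

theorem ae_tendsto_gibbsMagnetization (hgh : ∀ N, IsDisorder P a v (g N) (h N)) {β : ℝ}
    {U : Set ℝ} {K : ℝ} (hK : 0 < K)
    (hle : ∀ N : ℕ, ∫ ω, gibbsMagnetization β B (fun k => g N k ω) (fun i => h N i ω) U ∂P
        ≤ K * Real.exp (-(N : ℝ) / K)) :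
    ∀ᵐ ω ∂P, Tendsto
      (fun N : ℕ => gibbsMagnetization β B (fun k => g N k ω) (fun i => h N i ω) U) atTop (𝓝 0) := by
  have habs : ∀ N ω, |gibbsMagnetization β B (fun k => g N k ω) (fun i => h N i ω) U|
      = gibbsMagnetization β B (fun k => g N k ω) (fun i => h N i ω) U := fun N ω =>
    abs_of_nonneg (gibbsMagnetization_nonneg _ _ _ _ _)
  have hsum : Summable fun N : ℕ => K * Real.exp (-(N : ℝ) / K) := by
    refine Summable.mul_left _ ?_
    have h1 : ∀ N : ℕ, Real.exp (-(N : ℝ) / K) = Real.exp (-1 / K) ^ N := fun N => by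
      rw [← Real.exp_nat_mul]
      congr 1
      ring
    simp only [h1]
    refine summable_geometric_of_lt_one (Real.exp_pos _).le ?_
    rw [Real.exp_lt_one_iff]
    exact div_neg_of_neg_of_pos (by norm_num) hK
  have h1 := (ae_summable_abs_and_integrable_tsum
    (fun N => (hgh N).integrable_gibbsMagnetization (B := B) β U) (by
      simp only [habs]
      exact Summable.of_nonneg_of_le
        (fun N => integral_nonneg fun ω => gibbsMagnetization_nonneg _ _ _ _ _) hle hsum)).1
  filter_upwards [h1] with ω hω
  simp only [habs] at hω
  exact hω.tendsto_atTop_zero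

end

end SKFI

theorem mainTheorem7 {Ω : Type*} [MeasurableSpace Ω] (P : Measure Ω) [IsProbabilityMeasure P]
    (β : ℝ) (hβ : 0 ≤ β)
    (B : ℕ+ → ℝ) (hB : Summable fun p : ℕ+ => (2 : ℝ) ^ (p : ℕ) * B p ^ 2)
    (a : ℝ) (v : ℝ≥0)
    (g : ∀ N, SKFI.CouplingIndex N → Ω → ℝ) (h : ∀ N, Fin N → Ω → ℝ)
    (hgh : ∀ N, SKFI.IsDisorder P a v (g N) (h N)) :
    (∀ μ ∈ Icc (-1 : ℝ) 1,
      Tendsto (fun N : ℕ => SKFI.freeEnergySK P B (g N) fun i ω => β * μ + h N i ω) atTop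
        (𝓝 (SKFI.limitFreeEnergySK P B g h (β * μ)))) ∧
    ∀ U : Set ℝ, (∃ V : Set ℝ, IsOpen V ∧ U = V ∩ Icc (-1) 1) →
      (∃ δ : ℝ, 0 < δ ∧ ∀ x ∈ U, ∀ y ∈ SKFI.argmaxSet P β B g h, δ ≤ |x - y|) →
      (∃ K : ℝ, 0 < K ∧ ∀ N : ℕ, 1 ≤ N →
        ∫ ω, SKFI.gibbsMagnetization β B (fun k => g N k ω) (fun i => h N i ω) U ∂P
          ≤ K * Real.exp (-(N : ℝ) / K)) ∧
      ∀ᵐ ω ∂P, Tendsto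
        (fun N : ℕ => SKFI.gibbsMagnetization β B (fun k => g N k ω) (fun i => h N i ω) U)
        atTop (𝓝 0) := by
  refine ⟨fun μ _ => SKFI.tendsto_freeEnergySK hgh hB (β * μ), ?_⟩
  rintro U ⟨V, -, rfl⟩ ⟨δ, hδ, hsep⟩
  obtain ⟨K, hK, hle⟩ := SKFI.exists_integral_gibbsMagnetization_le hgh hB hβ inter_subset_right hδ
    hsep
  exact ⟨⟨K, hK, fun N _ => hle N⟩, SKFI.ae_tendsto_gibbsMagnetization hgh hK hle⟩
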